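/- Let $R$ and $B$ be finite, nonempty, disjoint sets of real numbers; $x\in R$ (resp. $x\in B$) stands for a red (resp. blue) point $(x,0)$ on the line $y=0$ in the Euclidean plane. A non-crossing bichromatic spanning tree of $R\cup B$ is a tree with vertex set $R\cup B$, each of whose edges joins a red point with a blue point, such that the edges can be drawn as circular arcs in the half-plane $y\ge 0$ between their endpoints so that any two of these arcs meet at most in a common endpoint. Its weight is the sum, over its edges, of the Euclidean distance of the two endpoints. Theorem. A minimum-weight non-crossing bichromatic spanning tree of $R\cup B$ can be computed in quadratic time. Precisely: there are a real-RAM program $P$ and a constant $C$ such that for all $R$ and $B$ as above, given the red points and the blue points as two lists, each in arbitrary order, $P$ halts after at most $C\,(|R|+|B|)^2$ steps and outputs a list, without repetition, of the edges of a non-crossing bichromatic spanning tree of $R\cup B$ whose weight is minimum among all such trees. Here a real RAM is a random access machine with memory cells for natural numbers and memory cells for real numbers and with indirect addressing, in which each assignment, array access, addition, subtraction and comparison takes one step. (No other arithmetic operations are needed; there is no rounding and no conversion of real numbers to natural numbers.) -/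

import Mathlib

/-! ### Bichromatic geometric trees on the line `y = 0` with edges drawn as arcs above it -/

/-- The point `(x, 0)` of the Euclidean plane. -/
noncomputable def linePoint (x : ℝ) : EuclideanSpace ℝ (Fin 2) := !₂[x, 0]

/-- The circular arc in the closed half-plane `y ≥ 0` with endpoints `(a, 0)` and `(b, 0)` that lies
on the circle with centre `((a + b) / 2, h)`. For `a ≠ b`, as `h` ranges over `ℝ`, these are all the
circular arcs above `y = 0` that join the two points. -/
def arcAbove (a b h : ℝ) : Set (EuclideanSpace ℝ (Fin 2)) :=
  {p | dist p !₂[(a + b) / 2, h] = dist (linePoint a) !₂[(a + b) / 2, h] ∧ 0 ≤ p 1}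

/-- The two endpoints of the edge `e`. An edge is a pair
(coordinate of its red endpoint, coordinate of its blue endpoint). -/
def edgeEnds (e : ℝ × ℝ) : Set (EuclideanSpace ℝ (Fin 2)) := {linePoint e.1, linePoint e.2}

/-- The edges of `T` can be drawn as circular arcs above `y = 0` so that any two of the arcs meet
at most in a common endpoint. -/
def IsNonCrossing (T : Finset (ℝ × ℝ)) : Prop :=
  ∃ h : ℝ × ℝ → ℝ, ∀ e ∈ T, ∀ f ∈ T, e ≠ f →
    arcAbove e.1 e.2 (h e) ∩ arcAbove f.1 f.2 (h f) ⊆ edgeEnds e ∩ edgeEnds f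

/-- The graph with vertex set `R ∪ B` and edge set `T`. -/
def edgeGraph (R B : Finset ℝ) (T : Finset (ℝ × ℝ)) : SimpleGraph {x : ℝ // x ∈ R ∪ B} :=
  SimpleGraph.fromRel fun u v => (u.1, v.1) ∈ T

/-- `T` is a non-crossing bichromatic spanning tree of the red points `R` and the blue points `B`. -/
structure IsNonCrossingSpanningTree (R B : Finset ℝ) (T : Finset (ℝ × ℝ)) : Prop where
  bichromatic : T ⊆ R ×ˢ B
  isTree : (edgeGraph R B T).IsTree
  nonCrossing : IsNonCrossing T

/-- The sum of the Euclidean distances between the endpoints of the edges. -/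
noncomputable def treeWeight (T : Finset (ℝ × ℝ)) : ℝ :=
  ∑ e ∈ T, dist (linePoint e.1) (linePoint e.2)

/-- `T` is a minimum-weight non-crossing bichromatic spanning tree of `R` and `B`. -/
def IsOptimalNonCrossingSpanningTree (R B : Finset ℝ) (T : Finset (ℝ × ℝ)) : Prop :=
  IsNonCrossingSpanningTree R B T ∧
    ∀ T' : Finset (ℝ × ℝ), IsNonCrossingSpanningTree R B T' → treeWeight T ≤ treeWeight T'

/-! ### The real RAM

A random access machine with registers and arrays that hold natural numbers, and registers and
arrays that hold real numbers. A program is a finite term, so it uses a fixed finite number of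
registers and arrays. Array cells are addressed by the content of a natural number register.
Arithmetic is limited to addition and subtraction, also on the reals; the only other operations on
reals are comparison, copying and rational constants. In particular no real number can be
converted to a natural number, and there is no rounding. -/

namespace RealRAM

/-- The memory of the machine. -/
structure State where
  /-- registers for natural numbers -/
  nreg : ℕ → ℕ
  /-- registers for real numbers -/
  rreg : ℕ → ℝ
  /-- `narr a i` is cell `i` of the array number `a` of natural numbers -/
  narr : ℕ → ℕ → ℕ
  /-- `rarr a i` is cell `i` of the array number `a` of real numbers -/
  rarr : ℕ → ℕ → ℝ

/-- Elementary instructions. The first argument of an operation on registers is the destination. -/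
inductive Instr where
  | nconst (d k : ℕ)
  | nmove (d s : ℕ)
  | nadd (d s t : ℕ)
  | nsub (d s t : ℕ)
  | nload (d a i : ℕ)
  | nstore (a i s : ℕ)
  | rconst (d : ℕ) (q : ℚ)
  | rmove (d s : ℕ)
  | radd (d s t : ℕ)
  | rsub (d s t : ℕ)
  | rload (d a i : ℕ)
  | rstore (a i s : ℕ)

/-- The effect of an elementary instruction. Subtraction of natural numbers is truncated at `0`.
In `nload`, `nstore`, `rload`, `rstore` the accessed cell of the array `a` is the one whose index
is the content of register `i`. -/
noncomputable def Instr.apply : Instr → State → State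
  | nconst d k, σ => { σ with nreg := Function.update σ.nreg d k }
  | nmove d s, σ => { σ with nreg := Function.update σ.nreg d (σ.nreg s) }
  | nadd d s t, σ => { σ with nreg := Function.update σ.nreg d (σ.nreg s + σ.nreg t) }
  | nsub d s t, σ => { σ with nreg := Function.update σ.nreg d (σ.nreg s - σ.nreg t) }
  | nload d a i, σ => { σ with nreg := Function.update σ.nreg d (σ.narr a (σ.nreg i)) }
  | nstore a i s, σ =>
      let cells := Function.update (σ.narr a) (σ.nreg i) (σ.nreg s)
      { σ with narr := Function.update σ.narr a cells }
  | rconst d q, σ => { σ with rreg := Function.update σ.rreg d (q : ℝ) }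
  | rmove d s, σ => { σ with rreg := Function.update σ.rreg d (σ.rreg s) }
  | radd d s t, σ => { σ with rreg := Function.update σ.rreg d (σ.rreg s + σ.rreg t) }
  | rsub d s t, σ => { σ with rreg := Function.update σ.rreg d (σ.rreg s - σ.rreg t) }
  | rload d a i, σ => { σ with rreg := Function.update σ.rreg d (σ.rarr a (σ.nreg i)) }
  | rstore a i s, σ =>
      let cells := Function.update (σ.rarr a) (σ.nreg i) (σ.rreg s)
      { σ with rarr := Function.update σ.rarr a cells }

/-- Comparisons of two registers. -/
inductive Test where
  | nlt (s t : ℕ)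
  | neq (s t : ℕ)
  | rlt (s t : ℕ)

/-- The comparison succeeds. -/
def Test.Holds : Test → State → Prop
  | nlt s t, σ => σ.nreg s < σ.nreg t
  | neq s t, σ => σ.nreg s = σ.nreg t
  | rlt s t, σ => σ.rreg s < σ.rreg t

/-- Programs. -/
inductive Program where
  | skip
  | instr (c : Instr)
  | seq (p q : Program)
  | ite (b : Test) (p q : Program)
  | loop (b : Test) (p : Program)

/-- `Run p σ t τ`: started in the memory `σ`, the program `p` halts after `t` steps with the memory
`τ`. Each elementary instruction and each evaluation of a test is one step;
`loop b p` is `while b do p`. -/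
inductive Run : Program → State → ℕ → State → Prop where
  | skip (σ : State) : Run .skip σ 0 σ
  | instr (c : Instr) (σ : State) : Run (.instr c) σ 1 (c.apply σ)
  | seq {p q : Program} {σ τ υ : State} {t u : ℕ} :
      Run p σ t τ → Run q τ u υ → Run (.seq p q) σ (t + u) υ
  | ite_true {b : Test} {p q : Program} {σ τ : State} {t : ℕ} :
      b.Holds σ → Run p σ t τ → Run (.ite b p q) σ (t + 1) τ
  | ite_false {b : Test} {p q : Program} {σ τ : State} {t : ℕ} :
      ¬ b.Holds σ → Run q σ t τ → Run (.ite b p q) σ (t + 1) τ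
  | loop_true {b : Test} {p : Program} {σ τ υ : State} {t u : ℕ} :
      b.Holds σ → Run p σ t τ → Run (.loop b p) τ u υ → Run (.loop b p) σ (t + u + 1) υ
  | loop_false {b : Test} {p : Program} {σ : State} :
      ¬ b.Holds σ → Run (.loop b p) σ 1 σ

/-- The machine is deterministic: result and number of steps are determined by program and input. -/
theorem Run.unique {p : Program} {σ τ τ' : State} {t t' : ℕ}
    (h : Run p σ t τ) (h' : Run p σ t' τ') : t = t' ∧ τ = τ' := by
  induction h generalizing t' τ' with
  | skip σ => cases h'; exact ⟨rfl, rfl⟩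
  | instr c σ => cases h'; exact ⟨rfl, rfl⟩
  | seq _ _ ih1 ih2 =>
    cases h' with
    | seq a b =>
      obtain ⟨rfl, rfl⟩ := ih1 a
      obtain ⟨rfl, rfl⟩ := ih2 b
      exact ⟨rfl, rfl⟩
  | ite_true hb _ ih =>
    cases h' with
    | ite_true _ a => obtain ⟨rfl, rfl⟩ := ih a; exact ⟨rfl, rfl⟩
    | ite_false hb' _ => exact absurd hb hb'
  | ite_false hb _ ih =>
    cases h' with
    | ite_true hb' _ => exact absurd hb' hb
    | ite_false _ a => obtain ⟨rfl, rfl⟩ := ih a; exact ⟨rfl, rfl⟩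
  | loop_true hb _ _ ih1 ih2 =>
    cases h' with
    | loop_true _ a b =>
      obtain ⟨rfl, rfl⟩ := ih1 a
      obtain ⟨rfl, rfl⟩ := ih2 b
      exact ⟨rfl, rfl⟩
    | loop_false hb' => exact absurd hb hb'
  | loop_false hb =>
    cases h' with
    | loop_true hb' _ _ => exact absurd hb' hb
    | loop_false _ => exact ⟨rfl, rfl⟩

/-- The initial memory: natural number registers `0` and `1` hold the numbers of red and of blue
points, real arrays `0` and `1` hold the coordinates of the red and of the blue points, and
everything else is `0`. -/
noncomputable def inputState (reds blues : List ℝ) : State where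
  nreg := fun i => if i = 0 then reds.length else if i = 1 then blues.length else 0
  rreg := fun _ => 0
  narr := fun _ _ => 0
  rarr := fun a i => if a = 0 then reds.getD i 0 else if a = 1 then blues.getD i 0 else 0

/-- The list of edges in the output: natural number register `2` holds their number, and the
coordinates of the red and of the blue endpoint of edge `i` are in cell `i` of the real
arrays `2` and `3`. -/
def State.outputEdges (σ : State) : List (ℝ × ℝ) :=
  (List.range (σ.nreg 2)).map fun i => (σ.rarr 2 i, σ.rarr 3 i)

end RealRAM

/-! Sort the points and number them 0, …, n - 1. Arcs over interleaving intervals always meet above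
the line (`exists_mem_arcAbove_inter`), while semicircles over distinct intervals that do not
interleave meet at most in a common endpoint (`semicircle_inter`). The geometry therefore reduces to
bichromatic edge sets on indices without interleaving pairs.

A staircase on [i, j] consists of the edge (i, j) followed by a staircase on [i + 1, j] or on [i, j
- 1]. Consecutive edges share an end, so it is a non-crossing tree with j - i edges. A chain glues
staircases at common endpoints of alternating colours. The core is that no tree is lighter than the
best chain (`exists_chain_le`), by induction. If the outer edge (i, j) is absent, the longest edge
(i, m) at i lets the tree be split at m. If it is present, remove it: either the rest is still
connected, or it falls apart into connected sets on [i, k] and [k + 1, j]. Chains for the two parts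
are recombined with the edge (i, j) by `Chain.merge`: pairs of staircases are split off at the ends,
which only shortens the joining edge, until each side has at most one staircase. Then either the
edge extends a staircase or it is exchanged for the edge (k, k + 1).

Both optimizations are dynamic programs of quadratic cost: T(i, j) arises from T(i + 1, j) and T(i,
j - 1) in constant time, and F(j) is the minimum of F(m) + T(m, j) over m < j, capped at M. Edges
between equal colours are admitted at a penalty M above the optimum (`IsChainTable.le_mul`), so an
optimal chain contains none. Tracing the choices back lists n - 1 edges that join all points
(`EnumState`). They form a non-crossing tree of weight F(n - 1), which matches the lower bound
(`EnumState.isOptimal`). -/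

/-! ### Non-crossing edge sets on an interval of natural numbers -/

/-- `u` and `v` lie in the same component of the graph with edge set `E`. -/
def EdgeJoined (E : Finset (ℕ × ℕ)) : ℕ → ℕ → Prop := Relation.EqvGen fun a b => (a, b) ∈ E

theorem EdgeJoined.refl {E : Finset (ℕ × ℕ)} (u : ℕ) : EdgeJoined E u u := Relation.EqvGen.refl u

theorem EdgeJoined.symm {E : Finset (ℕ × ℕ)} {u v : ℕ} (h : EdgeJoined E u v) : EdgeJoined E v u :=
  Relation.EqvGen.symm _ _ h

theorem EdgeJoined.trans {E : Finset (ℕ × ℕ)} {u v w : ℕ} (h : EdgeJoined E u v) (h' : EdgeJoined E v w) :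
    EdgeJoined E u w := Relation.EqvGen.trans _ _ _ h h'

theorem EdgeJoined.of_mem {E : Finset (ℕ × ℕ)} {u v : ℕ} (h : (u, v) ∈ E) : EdgeJoined E u v :=
  Relation.EqvGen.rel _ _ h

/-- Applied below to retractions `ρ` of the index set: when every edge either survives or collapses
to a point, connectedness passes to a part of the edge set. -/
theorem EdgeJoined.map {E E' : Finset (ℕ × ℕ)} (ρ : ℕ → ℕ)
    (h : ∀ a b, (a, b) ∈ E → EdgeJoined E' (ρ a) (ρ b)) {u v : ℕ} (huv : EdgeJoined E u v) :
    EdgeJoined E' (ρ u) (ρ v) := by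
  induction huv with
  | rel a b hab => exact h a b hab
  | refl a => exact .refl _
  | symm a b _ ih => exact ih.symm
  | trans a b d _ _ ih1 ih2 => exact ih1.trans ih2

theorem EdgeJoined.mono {E E' : Finset (ℕ × ℕ)} (h : E ⊆ E') {u v : ℕ} (huv : EdgeJoined E u v) :
    EdgeJoined E' u v :=
  huv.map id fun _ _ hab => .of_mem (h hab)

/-- No two edges of `E` have interleaving endpoints. -/
def NoCross (E : Finset (ℕ × ℕ)) : Prop :=
  ∀ e ∈ E, ∀ f ∈ E, ¬ (e.1 < f.1 ∧ f.1 < e.2 ∧ e.2 < f.2)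

/-- A component that avoids both ends of an edge lies on one side of that edge. -/
theorem EdgeJoined.between_iff {E : Finset (ℕ × ℕ)} (hE : ∀ e ∈ E, e.1 < e.2) (hn : NoCross E)
    {a b i : ℕ} (hab : (a, b) ∈ E) (hia : ¬ EdgeJoined E i a) {u v : ℕ} (huv : EdgeJoined E u v)
    (hiu : EdgeJoined E i u) : (a < u ∧ u < b) ↔ (a < v ∧ v < b) := by
  have hib : ¬ EdgeJoined E i b := fun h => hia (h.trans (EdgeJoined.of_mem hab).symm)
  induction huv with
  | rel u v huv =>
    have hiv := hiu.trans (.of_mem huv)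
    have h1 : u ≠ a := by rintro rfl; exact hia hiu
    have h2 : u ≠ b := by rintro rfl; exact hib hiu
    have h3 : v ≠ a := by rintro rfl; exact hia hiv
    have h4 : v ≠ b := by rintro rfl; exact hib hiv
    -- An edge of the component with exactly one end between `a` and `b` would interleave with `(a,
    -- b)`, in one of the two orders.
    have h5 := hn _ hab _ huv
    have h6 := hn _ huv _ hab
    have h7 := hE _ huv
    have h8 := hE _ hab
    simp only at h5 h6 h7 h8
    omega
  | refl u => rfl
  | symm u v huv ih =>
    exact (ih (hiu.trans (EdgeJoined.symm huv))).symm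
  | trans u v w huv _ ih1 ih2 =>
    exact (ih1 hiu).trans (ih2 (hiu.trans huv))

/-! ### Chains of staircases -/

/-- There is a sequence of indices from `i` to `j` with alternating colours `c`, the sum of `T` over
its steps being at most `v`. -/
inductive Chain (c : ℕ → ℕ) (T : ℕ → ℕ → ℝ) : ℕ → ℕ → ℝ → Prop
  | nil {i : ℕ} {v : ℝ} : 0 ≤ v → Chain c T i i v
  | cons {i m j : ℕ} {u v : ℝ} : i < m → c i ≠ c m → Chain c T m j u → T i m + u ≤ v →
      Chain c T i j v

section Chain

variable {c : ℕ → ℕ} {T : ℕ → ℕ → ℝ}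

theorem Chain.mono {i j : ℕ} {u v : ℝ} (h : Chain c T i j u) (huv : u ≤ v) : Chain c T i j v := by
  cases h with
  | nil h0 => exact .nil (h0.trans huv)
  | cons h1 h2 h3 h4 => exact .cons h1 h2 h3 (h4.trans huv)

theorem Chain.le {i j : ℕ} {u : ℝ} (h : Chain c T i j u) : i ≤ j := by
  induction h with
  | nil h0 => exact le_rfl
  | cons h1 _ _ _ ih => exact h1.le.trans ih

theorem Chain.single {i j : ℕ} (hij : i < j) (hc : c i ≠ c j) {v : ℝ} (h : T i j ≤ v) :
    Chain c T i j v :=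
  .cons hij hc (.nil le_rfl) (by simpa using h)

theorem Chain.append {i j k : ℕ} {u v : ℝ} (h : Chain c T i j u) (h' : Chain c T j k v) :
    Chain c T i k (u + v) := by
  induction h with
  | nil h0 => exact h'.mono (by linarith)
  | cons h1 h2 _ h4 ih => exact .cons h1 h2 (ih h') (by linarith)

/-- Two steps are split off at once because with two colours this leads back to the colour of `i`.
In `Chain.merge` the remaining problem then has ends of different colours again. -/
theorem Chain.cases_left {i j : ℕ} {v : ℝ} (hc : ∀ i, c i < 2) (h : Chain c T i j v) :
    (i = j ∧ 0 ≤ v) ∨ (i < j ∧ c i ≠ c j ∧ T i j ≤ v) ∨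
      ∃ m u u', i < m ∧ c i = c m ∧ Chain c T i m u ∧ Chain c T m j u' ∧ u + u' ≤ v := by
  cases h with
  | nil h0 => exact .inl ⟨rfl, h0⟩
  | @cons _ m _ u _ h1 h2 h3 h4 =>
    cases h3 with
    | nil h0 => exact .inr (.inl ⟨h1, h2, by linarith⟩)
    | @cons _ m' _ u' _ k1 k2 k3 k4 =>
      refine .inr (.inr ⟨m', T i m + T m m', u', h1.trans k1, ?_, ?_, k3, by linarith⟩)
      · have := hc i; have := hc m; have := hc m'; omega
      · exact (Chain.single h1 h2 le_rfl).append (.single k1 k2 le_rfl)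

theorem Chain.snoc_view {i j : ℕ} {v : ℝ} (h : Chain c T i j v) :
    (i = j ∧ 0 ≤ v) ∨ ∃ m u, m < j ∧ c m ≠ c j ∧ Chain c T i m u ∧ u + T m j ≤ v := by
  induction h with
  | nil h0 => exact .inl ⟨rfl, h0⟩
  | @cons i m j u v h1 h2 h3 h4 ih =>
    rcases ih with ⟨rfl, h⟩ | ⟨m', u', k1, k2, k3, k4⟩
    · exact .inr ⟨i, 0, h1, h2, .nil le_rfl, by linarith⟩
    · exact .inr ⟨m', T i m + u', k1, k2, .cons h1 h2 k3 le_rfl, by linarith⟩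

theorem Chain.cases_right {i j : ℕ} {v : ℝ} (hc : ∀ i, c i < 2) (h : Chain c T i j v) :
    (i = j ∧ 0 ≤ v) ∨ (i < j ∧ c i ≠ c j ∧ T i j ≤ v) ∨
      ∃ m u u', m < j ∧ c m = c j ∧ Chain c T i m u ∧ Chain c T m j u' ∧ u + u' ≤ v := by
  rcases h.snoc_view with h | ⟨m, u, h1, h2, h3, h4⟩
  · exact .inl h
  · rcases h3.snoc_view with ⟨rfl, h⟩ | ⟨m', u', k1, k2, k3, k4⟩
    · exact .inr (.inl ⟨h1, h2, by linarith⟩)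
    · refine .inr (.inr ⟨m', u', T m' m + T m j, k1.trans h1, ?_, k3, ?_, by linarith⟩)
      · have := hc j; have := hc m; have := hc m'; omega
      · exact (Chain.single k1 k2 le_rfl).append (.single h1 h2 le_rfl)

/-- Two adjacent chains and an edge joining their outer ends can be replaced by a chain. -/
theorem Chain.merge {x : ℕ → ℝ} {n : ℕ} (hc : ∀ i, c i < 2) (hx : MonotoneOn x (Set.Iio n))
    (hT0 : ∀ i, T i i = 0)
    (hTl : ∀ i j, i < j → j < n → c i ≠ c j → T i j ≤ x j - x i + T (i + 1) j)
    (hTr : ∀ i j, i < j → j < n → c i ≠ c j → T i j ≤ x j - x i + T i (j - 1)) :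
    ∀ (N i k j : ℕ) (u v : ℝ), j - i ≤ N → j < n → c i ≠ c j → Chain c T i k u →
      Chain c T (k + 1) j v → Chain c T i j (x j - x i + u + v) := by
  intro N
  induction N with
  | zero =>
    intro i k j u v hN _ _ h h'
    have := h.le; have := h'.le; omega
  | succ N ih =>
    intro i k j u v hN hj hij h h'
    have hik := h.le
    have hkj := h'.le
    have hmono : ∀ a b, a ≤ b → b < n → x a ≤ x b := fun a b hab hb =>
      hx (Set.mem_Iio.2 (hab.trans_lt hb)) (Set.mem_Iio.2 hb) hab
    -- If the left chain has two or more steps, split off two. The edge from `m` to `j` is still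
    -- bichromatic and not longer than the one from `i` to `j`, so the induction hypothesis covers
    -- the rest. The right chain is treated symmetrically.
    rcases h.cases_left hc with ⟨rfl, hu⟩ | ⟨hlt, hck, hu⟩ | ⟨m, u1, u2, h1, h2, h3, h4, h5⟩
    rotate_left 2
    · have hm := h4.le
      have := ih m k j u2 v (by omega) hj (by omega) h4 h'
      refine (h3.append this).mono ?_
      have := hmono i m h1.le (by omega)
      linarith
    all_goals
      rcases h'.cases_right hc with ⟨rfl, hv⟩ | ⟨hlt', hck', hv⟩ | ⟨m, v1, v2, k1, k2, k3, k4, k5⟩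
      rotate_left 2
      · have hm := k3.le
        have := ih i _ m u v1 (by omega) (by omega) (by omega) h k3
        refine (this.append k4).mono ?_
        have := hmono m j k1.le (by omega)
        linarith
    -- Each side is now empty or a single staircase. Unless both are single staircases, putting the
    -- edge `(i, j)` in front gives one staircase on `[i, j]`.
    · have := hTl i (i + 1) (by omega) hj hij
      exact .single (by omega) hij (by rw [hT0] at this; linarith)
    · have := hTl i j (by omega) hj hij
      exact .single (by omega) hij (by linarith)
    · have := hTr i (k + 1) (by omega) hj hij
      exact .single (by omega) hij (by simp only [Nat.add_sub_cancel] at this; linarith)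
    -- With a staircase on each side the colours force `c k ≠ c (k + 1)`, and the edge `(i, j)` is
    -- exchanged for `(k, k + 1)`, which is not longer.
    · have hcc : c k ≠ c (k + 1) := by
        have := hc i; have := hc j; have := hc k; have := hc (k + 1); omega
      have hs := hTl k (k + 1) (by omega) (by omega) hcc
      rw [hT0] at hs
      refine ((Chain.single hlt hck hu).append
        ((Chain.single (by omega) hcc hs).append (.single hlt' hck' hv))).mono ?_
      have := hmono i k hik (by omega)
      have := hmono (k + 1) j hkj (by omega)
      linarith

/-- A connected non-crossing bichromatic edge set on `[i, j]` weighs at least as much as some chain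
from `i` to `j`. -/
theorem exists_chain_le {x : ℕ → ℝ} {n : ℕ} (hc : ∀ i, c i < 2) (hx : MonotoneOn x (Set.Iio n))
    (hT0 : ∀ i, T i i = 0)
    (hTl : ∀ i j, i < j → j < n → c i ≠ c j → T i j ≤ x j - x i + T (i + 1) j)
    (hTr : ∀ i j, i < j → j < n → c i ≠ c j → T i j ≤ x j - x i + T i (j - 1)) :
    ∀ (N i j : ℕ) (E : Finset (ℕ × ℕ)), j - i + E.card ≤ N → i ≤ j → j < n →
      (∀ e ∈ E, i ≤ e.1 ∧ e.1 < e.2 ∧ e.2 ≤ j ∧ c e.1 ≠ c e.2) → NoCross E →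
      (∀ u, i ≤ u → u ≤ j → EdgeJoined E i u) → Chain c T i j (∑ e ∈ E, (x e.2 - x e.1)) := by
  -- Induction on `j - i` plus the number of edges: removing the outer edge lowers the second
  -- summand, splitting at an inner point lowers the first.
  intro N
  induction N with
  | zero =>
    intro i j E hN hij hj hE hn hconn
    have : E = ∅ := by rw [← Finset.card_eq_zero]; omega
    subst this
    obtain rfl : i = j := by omega
    exact .nil (by simp)
  | succ N ih =>
    intro i j E hN hij hj hE hn hconn
    have hmono : ∀ a b, a ≤ b → b < n → x a ≤ x b := fun a b hab hb =>
      hx (Set.mem_Iio.2 (hab.trans_lt hb)) (Set.mem_Iio.2 hb) hab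
    have hnn : ∀ e ∈ E, 0 ≤ x e.2 - x e.1 := fun e he => by
      have := hE e he
      have := hmono e.1 e.2 this.2.1.le (by omega)
      linarith
    have hsplit : ∀ E1 E2 : Finset (ℕ × ℕ), E1 ⊆ E → E2 ⊆ E → Disjoint E1 E2 →
        ∑ e ∈ E1, (x e.2 - x e.1) + ∑ e ∈ E2, (x e.2 - x e.1) ≤ ∑ e ∈ E, (x e.2 - x e.1) := by
      intro E1 E2 h1 h2 hd
      rw [← Finset.sum_union hd]
      exact Finset.sum_le_sum_of_subset_of_nonneg (Finset.union_subset h1 h2)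
        fun e he _ => hnn e he
    rcases hij.eq_or_lt with rfl | hlt
    · exact .nil (Finset.sum_nonneg hnn)
    by_cases hmem : (i, j) ∈ E
    · set E' := E.erase (i, j) with hE'
      have hsub : E' ⊆ E := Finset.erase_subset _ _
      have hn' : NoCross E' := fun e he f hf => hn e (hsub he) f (hsub hf)
      have hw : ∑ e ∈ E, (x e.2 - x e.1) = (x j - x i) + ∑ e ∈ E', (x e.2 - x e.1) :=
        (Finset.add_sum_erase E (fun e => x e.2 - x e.1) hmem).symm
      have hcard : E'.card + 1 = E.card := Finset.card_erase_add_one hmem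
      have hij' := hmono i j hij hj
      by_cases hJ : EdgeJoined E' i j
      · refine (ih i j E' (by omega) hij hj (fun e he => hE e (hsub he)) hn' ?_).mono (by linarith)
        intro u hu hu'
        refine (hconn u hu hu').map id fun a b hab => ?_
        by_cases h : (a, b) = (i, j)
        · obtain ⟨rfl, rfl⟩ := Prod.mk.inj h; exact hJ
        · exact .of_mem (Finset.mem_erase.2 ⟨h, hab⟩)
      · classical
        -- `K` is the last point of the component of `i`. The remaining edges fall apart between `K`
        -- and `K + 1`.
        obtain ⟨K, hK1, hK2, hKmax⟩ : ∃ K, K ≤ j ∧ EdgeJoined E' i K ∧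
            ∀ u, u ≤ j → EdgeJoined E' i u → u ≤ K := by
          refine ⟨Nat.findGreatest (fun u => EdgeJoined E' i u) j, Nat.findGreatest_le _, ?_, ?_⟩
          · exact Nat.findGreatest_spec (P := fun u => EdgeJoined E' i u) hij (.refl i)
          · exact fun u hu h => Nat.le_findGreatest hu h
        have hKi : i ≤ K := hKmax i hij (.refl i)
        have hKj : K < j := lt_of_le_of_ne hK1 (by rintro rfl; exact hJ hK2)
        -- An edge over this gap cannot touch the component of `i`, which ends at `K`. It would then
        -- have `K` inside and `i` outside, contrary to `EdgeJoined.between_iff`.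
        have hgap : ∀ a b, (a, b) ∈ E' → b ≤ K ∨ K < a := by
          intro a b hab
          by_contra! hcon
          have hb := hE _ (hsub hab)
          simp only at hb
          have hia : ¬ EdgeJoined E' i a := fun h => by
            have := hKmax b hb.2.2.1 (h.trans (.of_mem hab)); omega
          have hne : a ≠ K := by rintro rfl; exact hia hK2
          have := (EdgeJoined.between_iff (fun e he => (hE e (hsub he)).2.1) hn' hab hia hK2
            (.refl i)).2 ⟨by omega, hcon.1⟩
          omega
        set E1 := E'.filter fun e => e.2 ≤ K with hE1
        set E2 := E'.filter fun e => K < e.1 with hE2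
        have s1 : E1 ⊆ E' := Finset.filter_subset _ _
        have s2 : E2 ⊆ E' := Finset.filter_subset _ _
        have hd : Disjoint E1 E2 := by
          rw [Finset.disjoint_left]
          intro e he he'
          have h1 := (Finset.mem_filter.1 he).2
          have h2 := (Finset.mem_filter.1 he').2
          have := hE e (hsub (s1 he))
          omega
        have hsum : ∑ e ∈ E1, (x e.2 - x e.1) + ∑ e ∈ E2, (x e.2 - x e.1)
            ≤ ∑ e ∈ E', (x e.2 - x e.1) := by
          rw [← Finset.sum_union hd]
          exact Finset.sum_le_sum_of_subset_of_nonneg (Finset.union_subset s1 s2)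
            fun e he _ => hnn e (hsub he)
        have c1 := Finset.card_le_card s1
        have c2 := Finset.card_le_card s2
        have hch1 : Chain c T i K (∑ e ∈ E1, (x e.2 - x e.1)) := by
          refine ih i K E1 (by omega) hKi (by omega) (fun e he => ?_)
            (fun e he f hf => hn' e (s1 he) f (s1 hf)) ?_
          · have h1 := (Finset.mem_filter.1 he).2
            have := hE e (hsub (s1 he))
            exact ⟨this.1, this.2.1, h1, this.2.2.2⟩
          · intro u hu hu'
            -- Sending everything beyond `K` to `i` is a retraction onto `[i, K]` that collapses the
            -- removed edge `(i, j)`. For the right part, everything up to `K` is sent to `j`.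
            have := (hconn u hu (by omega)).map (E' := E1) (fun y => if y ≤ K then y else i) ?_
            · simpa [hu', hKi] using this
            · intro a b hab
              by_cases h : (a, b) = (i, j)
              · obtain ⟨rfl, rfl⟩ := Prod.mk.inj h
                simp only [hKi, if_true, if_neg (not_le.2 hKj)]
                exact .refl _
              · have hab' : (a, b) ∈ E' := Finset.mem_erase.2 ⟨h, hab⟩
                have hlt := (hE _ hab).2.1
                simp only at hlt
                rcases hgap a b hab' with h | h
                · simp only [h, if_true, if_pos (hlt.le.trans h)]
                  exact .of_mem (Finset.mem_filter.2 ⟨hab', h⟩)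
                · simp only [if_neg (not_le.2 h), if_neg (not_le.2 (h.trans hlt))]
                  exact .refl _
        have hch2 : Chain c T (K + 1) j (∑ e ∈ E2, (x e.2 - x e.1)) := by
          refine ih (K + 1) j E2 (by omega) hKj (by omega) (fun e he => ?_)
            (fun e he f hf => hn' e (s2 he) f (s2 hf)) ?_
          · have h1 := (Finset.mem_filter.1 he).2
            have := hE e (hsub (s2 he))
            exact ⟨h1, this.2.1, this.2.2.1, this.2.2.2⟩
          · have key : ∀ u, K < u → u ≤ j → EdgeJoined E2 j u := by
              intro u hu hu'
              have := (hconn u (by omega) (by omega)).map (E' := E2)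
                (fun y => if y ≤ K then j else y) ?_
              · simpa [hu, hKi, not_le.2 hu] using this
              · intro a b hab
                by_cases h : (a, b) = (i, j)
                · obtain ⟨rfl, rfl⟩ := Prod.mk.inj h
                  simp only [hKi, if_true, if_neg (not_le.2 hKj)]
                  exact .refl _
                · have hab' : (a, b) ∈ E' := Finset.mem_erase.2 ⟨h, hab⟩
                  have hlt := (hE _ hab).2.1
                  simp only at hlt
                  rcases hgap a b hab' with h | h
                  · simp only [h, if_true, if_pos (hlt.le.trans h)]
                    exact .refl _
                  · simp only [if_neg (not_le.2 h), if_neg (not_le.2 (h.trans hlt))]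
                    exact .of_mem (Finset.mem_filter.2 ⟨hab', h⟩)
            exact fun u hu hu' => (key (K + 1) (by omega) (by omega)).symm.trans (key u hu hu')
        exact (Chain.merge hc hx hT0 hTl hTr _ i K j _ _ le_rfl hj (hE _ hmem).2.2.2 hch1
          hch2).mono (by linarith)
    · have hnb : ∃ m, (i, m) ∈ E := by
        by_contra! hcon
        have key : ∀ u, EdgeJoined E i u → u = i := by
          intro u hu
          -- If no edge met `i`, the indicator of `i` would be constant on components, being a map
          -- into an edgeless graph.
          have := hu.map (E' := ∅) (fun y => if y = i then 0 else 1) ?_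
          · by_contra hui
            have h01 : ∀ a b, EdgeJoined ∅ a b → a = b := by
              intro a b h
              induction h with
              | rel a b h => simp at h
              | refl a => rfl
              | symm a b _ ih => exact ih.symm
              | trans a b d _ _ h1 h2 => exact h1.trans h2
            simpa [hui] using h01 _ _ this
          · intro a b hab
            have h1 : a ≠ i := by rintro rfl; exact hcon b hab
            have := hE _ hab
            simp only at this
            have h2 : b ≠ i := by omega
            simp only [h1, h2, if_false]
            exact .refl _
        have := key j (hconn j hij le_rfl)
        omega
      classical
      -- The split point is the far end of the longest edge at `i`.
      obtain ⟨m, hm, hmax⟩ : ∃ m, (i, m) ∈ E ∧ ∀ b, (i, b) ∈ E → b ≤ m := by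
        obtain ⟨m0, hm0⟩ := hnb
        have hle : ∀ b, (i, b) ∈ E → b ≤ j := fun b hb => (hE _ hb).2.2.1
        exact ⟨Nat.findGreatest (fun b => (i, b) ∈ E) j,
          Nat.findGreatest_spec (P := fun b => (i, b) ∈ E) (hle _ hm0) hm0,
          fun b hb => Nat.le_findGreatest (hle b hb) hb⟩
      have him := hE _ hm
      simp only at him
      have hmj : m < j := lt_of_le_of_ne him.2.2.1 (by rintro rfl; exact hmem hm)
      -- An edge passing over `m` would be a longer edge at `i`, or it would interleave with `(i,
      -- m)`.
      have hgap : ∀ a b, (a, b) ∈ E → b ≤ m ∨ m ≤ a := by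
        intro a b hab
        by_contra! hcon
        have h1 := hE _ hab
        simp only at h1
        rcases h1.1.eq_or_lt with rfl | h
        · have := hmax b hab; omega
        · exact hn _ hm _ hab ⟨h, hcon.2, hcon.1⟩
      set E1 := E.filter fun e => e.2 ≤ m with hE1
      set E2 := E.filter fun e => m ≤ e.1 with hE2
      have s1 : E1 ⊆ E := Finset.filter_subset _ _
      have s2 : E2 ⊆ E := Finset.filter_subset _ _
      have c1 := Finset.card_le_card s1
      have c2 := Finset.card_le_card s2
      have hd : Disjoint E1 E2 := by
        rw [Finset.disjoint_left]
        intro e he he'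
        have h1 := (Finset.mem_filter.1 he).2
        have h2 := (Finset.mem_filter.1 he').2
        have := hE e (s1 he)
        omega
      have hch1 : Chain c T i m (∑ e ∈ E1, (x e.2 - x e.1)) := by
        refine ih i m E1 (by omega) (by omega) (by omega) (fun e he => ?_)
          (fun e he f hf => hn e (s1 he) f (s1 hf)) ?_
        · have h1 := (Finset.mem_filter.1 he).2
          have := hE e (s1 he)
          exact ⟨this.1, this.2.1, h1, this.2.2.2⟩
        · intro u hu hu'
          -- As no edge passes over `m`, truncation at `m` keeps the edges of one part and collapses
          -- those of the other.
          have := (hconn u hu (by omega)).map (E' := E1) (fun y => min y m) ?_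
          · simpa [hu', him.2.1.le] using this
          · intro a b hab
            have hlt := (hE _ hab).2.1
            simp only at hlt
            rcases hgap a b hab with h | h
            · simp only [min_eq_left h, min_eq_left (hlt.le.trans h)]
              exact .of_mem (Finset.mem_filter.2 ⟨hab, h⟩)
            · simp only [min_eq_right h, min_eq_right (h.trans hlt.le)]
              exact .refl _
      have hch2 : Chain c T m j (∑ e ∈ E2, (x e.2 - x e.1)) := by
        refine ih m j E2 (by omega) (by omega) (by omega) (fun e he => ?_)
          (fun e he f hf => hn e (s2 he) f (s2 hf)) ?_
        · have h1 := (Finset.mem_filter.1 he).2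
          have := hE e (s2 he)
          exact ⟨h1, this.2.1, this.2.2.1, this.2.2.2⟩
        · intro u hu hu'
          have := (hconn u (by omega) (by omega)).map (E' := E2) (fun y => max y m) ?_
          · simpa [hu, him.2.1.le] using this
          · intro a b hab
            have hlt := (hE _ hab).2.1
            simp only at hlt
            rcases hgap a b hab with h | h
            · simp only [max_eq_right h, max_eq_right (hlt.le.trans h)]
              exact .refl _
            · simp only [max_eq_left h, max_eq_left (h.trans hlt.le)]
              exact .of_mem (Finset.mem_filter.2 ⟨hab, h⟩)
      exact (hch1.append hch2).mono (hsplit _ _ s1 s2 hd)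

end Chain

/-! ### Arcs above the line -/

theorem dist_linePoint (a b : ℝ) : dist (linePoint a) (linePoint b) = |a - b| := by
  rw [EuclideanSpace.dist_eq]
  simp [linePoint, Real.dist_eq, Real.sqrt_sq_eq_abs]

/-- The terms in `h ^ 2` cancel, so the difference of the equations of two arcs is linear in the
point: it describes the radical axis used below. -/
theorem mem_arcAbove {a b h : ℝ} {p : EuclideanSpace ℝ (Fin 2)} :
    p ∈ arcAbove a b h ↔ (p 0 - a) * (p 0 - b) + p 1 ^ 2 - 2 * h * p 1 = 0 ∧ 0 ≤ p 1 := by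
  unfold arcAbove
  rw [Set.mem_ofPred_eq, EuclideanSpace.dist_eq, EuclideanSpace.dist_eq,
    Real.sqrt_inj (by positivity) (by positivity)]
  simp only [Fin.sum_univ_two, Real.dist_eq, sq_abs, linePoint, PiLp.toLp_apply,
    Matrix.cons_val_zero, Matrix.cons_val_one]
  refine and_congr_left fun _ => ?_
  constructor <;> intro h <;> linarith

theorem linePoint_apply_zero (a : ℝ) : linePoint a 0 = a := by simp [linePoint]

theorem linePoint_apply_one (a : ℝ) : linePoint a 1 = 0 := by simp [linePoint]

theorem eq_linePoint_iff {p : EuclideanSpace ℝ (Fin 2)} {a : ℝ} :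
    p = linePoint a ↔ p 0 = a ∧ p 1 = 0 := by
  constructor
  · rintro rfl
    exact ⟨linePoint_apply_zero a, linePoint_apply_one a⟩
  · rintro ⟨h0, h1⟩
    ext i
    fin_cases i
    · simpa [linePoint] using h0
    · simpa [linePoint] using h1

/-- Arcs over interleaving intervals meet above the line. -/
theorem exists_mem_arcAbove_inter {a b a' b' : ℝ} (h h' : ℝ) (h1 : a < a') (h2 : a' < b)
    (h3 : b < b') : ∃ p ∈ arcAbove a b h ∩ arcAbove a' b' h', 0 < p 1 := by
  -- The radical axis of the two circles is the line of the points `(x0 + m * y, y)`.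
  set D := a' + b' - a - b with hD
  have hDpos : 0 < D := by linarith
  set x0 := (a' * b' - a * b) / D with hx0
  set m := 2 * (h - h') / D with hm
  have e0 : x0 * D = a' * b' - a * b := div_mul_cancel₀ _ hDpos.ne'
  have em : m * D = 2 * (h - h') := div_mul_cancel₀ _ hDpos.ne'
  -- The foot `x0` of the axis lies between `a'` and `b`, hence inside the first circle.
  have hneg : (x0 - a) * (x0 - b) < 0 := by
    have k1 : (x0 - a') * D = (a' - a) * (b - a') := by rw [sub_mul, e0, hD]; ring
    have k2 : (b - x0) * D = (b' - b) * (b - a') + 0 := by rw [sub_mul, e0, hD]; ring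
    have k3 : 0 < x0 - a' := by
      have : 0 < (x0 - a') * D := by rw [k1]; exact mul_pos (by linarith) (by linarith)
      exact (mul_pos_iff_of_pos_right hDpos).1 this
    have k4 : 0 < b - x0 := by
      have : 0 < (b - x0) * D := by
        rw [k2, add_zero]; exact mul_pos (by linarith) (by linarith)
      exact (mul_pos_iff_of_pos_right hDpos).1 this
    nlinarith
  set A := 1 + m ^ 2 with hA
  have hApos : 0 < A := by positivity
  set β := m * (2 * x0 - a - b) - 2 * h with hβ
  set γ := (x0 - a) * (x0 - b) with hγ
  -- On the axis the first circle reads `A * y ^ 2 + β * y + γ = 0`. Since `γ < 0 < A`, the larger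
  -- root is positive.
  set s := √(β ^ 2 - 4 * A * γ) with hs
  have hdisc : β ^ 2 < β ^ 2 - 4 * A * γ := by nlinarith
  have hs2 : s ^ 2 = β ^ 2 - 4 * A * γ := Real.sq_sqrt (by nlinarith [sq_nonneg β])
  have hsβ : β < s := by
    have : |β| < s := by
      rw [← Real.sqrt_sq_eq_abs]
      exact Real.sqrt_lt_sqrt (sq_nonneg β) hdisc
    exact (le_abs_self β).trans_lt this
  set y := (s - β) / (2 * A) with hy
  have hypos : 0 < y := div_pos (by linarith) (by linarith)
  have ey : y * (2 * A) = s - β := div_mul_cancel₀ _ (by positivity)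
  have hquad : A * y ^ 2 + β * y + γ = 0 := by
    have : 4 * A * (A * y ^ 2 + β * y + γ) = 0 := by
      have : 4 * A * (A * y ^ 2 + β * y + γ)
          = (y * (2 * A)) ^ 2 + 2 * β * (y * (2 * A)) + 4 * A * γ := by ring
      rw [this, ey]
      linarith [hs2]
    exact (mul_eq_zero.1 this).resolve_left (by positivity)
  clear_value y s γ β A m x0 D
  have p0 : (!₂[x0 + m * y, y] : EuclideanSpace ℝ (Fin 2)) 0 = x0 + m * y := by simp
  have p1 : (!₂[x0 + m * y, y] : EuclideanSpace ℝ (Fin 2)) 1 = y := by simp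
  have hfst : (x0 + m * y - a) * (x0 + m * y - b) + y ^ 2 - 2 * h * y = 0 := by
    rw [← hquad, hA, hβ, hγ]; ring
  refine ⟨!₂[x0 + m * y, y], ⟨?_, ?_⟩, by rw [p1]; exact hypos⟩
  · rw [mem_arcAbove, p0, p1]
    exact ⟨hfst, hypos.le⟩
  · rw [mem_arcAbove, p0, p1]
    refine ⟨?_, hypos.le⟩
    rw [hD] at e0 em
    linear_combination hfst - e0 - y * em

theorem arcAbove_comm (a b h : ℝ) : arcAbove a b h = arcAbove b a h := by
  ext p
  rw [mem_arcAbove, mem_arcAbove, mul_comm]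

/-- Semicircles over two distinct intervals that do not interleave meet only on the line, in a
common endpoint. -/
theorem semicircle_inter {a b a' b' : ℝ} (hab : a < b) (hab' : a' < b') (hne : (a, b) ≠ (a', b'))
    (h1 : ¬ (a < a' ∧ a' < b ∧ b < b')) (h2 : ¬ (a' < a ∧ a < b' ∧ b' < b))
    {p : EuclideanSpace ℝ (Fin 2)} (hp : p ∈ arcAbove a b 0) (hp' : p ∈ arcAbove a' b' 0) :
    p 1 = 0 ∧ (p 0 = a ∨ p 0 = b) ∧ (p 0 = a' ∨ p 0 = b') := by
  rw [mem_arcAbove] at hp hp'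
  obtain ⟨hp, hy⟩ := hp
  obtain ⟨hp', -⟩ := hp'
  generalize p 0 = x at *
  generalize p 1 = y at *
  have hy0 : y = 0 := by
    by_contra hy0
    have hypos : 0 < y ^ 2 := by positivity
    have k1 : (x - a) * (x - b) < 0 := by linarith
    have k2 : (x - a') * (x - b') < 0 := by linarith
    have ha : a < x := by nlinarith
    have hb : x < b := by nlinarith
    have ha' : a' < x := by nlinarith
    have hb' : x < b' := by nlinarith
    -- Both sides equal `y ^ 2`. If one interval strictly contains the other, its product is
    -- strictly larger at an interior point.
    have heq : (x - a) * (b - x) = (x - a') * (b' - x) := by linarith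
    rcases lt_trichotomy a a' with h | h | h
    · have hb2 : b' ≤ b := by by_contra! hcon; exact h1 ⟨h, by linarith, hcon⟩
      nlinarith
    · subst h
      rcases lt_trichotomy b b' with h | h | h
      · nlinarith
      · exact hne (by rw [h])
      · nlinarith
    · have hb2 : b ≤ b' := by by_contra! hcon; exact h2 ⟨h, by linarith, hcon⟩
      nlinarith
  subst hy0
  refine ⟨rfl, ?_, ?_⟩
  · have : (x - a) * (x - b) = 0 := by linarith
    rcases mul_eq_zero.1 this with h | h
    · left; linarith
    · right; linarith
  · have : (x - a') * (x - b') = 0 := by linarith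
    rcases mul_eq_zero.1 this with h | h
    · left; linarith
    · right; linarith

/-! ### Weights of staircases and chains -/

/-- The length of the edge `(i, j)`, or the penalty `M` if its endpoints have the same colour. -/
noncomputable def edgeCost (x : ℕ → ℝ) (c : ℕ → ℕ) (M : ℝ) (i j : ℕ) : ℝ :=
  if c i = c j then M else x j - x i

/-- The minimum weight of a staircase on `[i, i + d]`: a sequence of intervals that starts with
`[i, i + d]`, each of the following ones being obtained by dropping an end of its predecessor. -/
noncomputable def fanCost (x : ℕ → ℝ) (c : ℕ → ℕ) (M : ℝ) : ℕ → ℕ → ℝ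
  | 0, _ => 0
  | d + 1, i => edgeCost x c M i (i + d + 1) + min (fanCost x c M d (i + 1)) (fanCost x c M d i)

/-- The minimum weight of a staircase on `[i, j]`. -/
noncomputable def stairCost (x : ℕ → ℝ) (c : ℕ → ℕ) (M : ℝ) (i j : ℕ) : ℝ :=
  fanCost x c M (j - i) i

/-- `F j` is the minimum of `M` and of the weights of chains of staircases on `[0, j]`, and `p j` is
the start of the last staircase of an optimal one. -/
structure IsChainTable (T : ℕ → ℕ → ℝ) (M : ℝ) (n : ℕ) (F : ℕ → ℝ) (p : ℕ → ℕ) : Prop where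
  zero : F 0 = 0
  pred_zero : p 0 = 0
  le : ∀ j < n, ∀ m < j, F j ≤ F m + T m j
  pred : ∀ j < n, 0 < j → F j = M ∨ (p j < j ∧ F j = F (p j) + T (p j) j)

section Weights

variable {x : ℕ → ℝ} {c : ℕ → ℕ} {M : ℝ} {n : ℕ}

theorem stairCost_self (i : ℕ) : stairCost x c M i i = 0 := by simp [stairCost, fanCost]

theorem stairCost_of_lt {i j : ℕ} (h : i < j) :
    stairCost x c M i j =
      edgeCost x c M i j + min (stairCost x c M (i + 1) j) (stairCost x c M i (j - 1)) := by
  obtain ⟨d, rfl⟩ := Nat.exists_eq_add_of_lt h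
  have h1 : i + d + 1 - i = d + 1 := by omega
  have h2 : i + d + 1 - (i + 1) = d := by omega
  have h3 : i + d + 1 - 1 - i = d := by omega
  simp only [stairCost, h1, h2, h3, fanCost]

theorem edgeCost_nonneg (hx : MonotoneOn x (Set.Iio n)) (hM : 0 ≤ M) {i j : ℕ} (hij : i ≤ j)
    (hj : j < n) : 0 ≤ edgeCost x c M i j := by
  unfold edgeCost
  split_ifs
  · exact hM
  · exact sub_nonneg.2 (hx (Set.mem_Iio.2 (by omega)) (Set.mem_Iio.2 hj) hij)

/-- The table inequality holds for every `m < j`, so the colours along the chain play no role. -/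
theorem Chain.table_le {T : ℕ → ℕ → ℝ} {F : ℕ → ℝ} {p : ℕ → ℕ} (h : IsChainTable T M n F p)
    {i j : ℕ} {v : ℝ} (hch : Chain c T i j v) (hj : j < n) : F j ≤ F i + v := by
  induction hch with
  | nil h0 => linarith
  | @cons i m j u v h1 h2 h3 h4 ih =>
    have := ih hj
    have := h.le m (h3.le.trans_lt hj) i h1
    linarith

theorem stairCost_le_left {i j : ℕ} (hij : i < j) (hc : c i ≠ c j) :
    stairCost x c M i j ≤ x j - x i + stairCost x c M (i + 1) j := by
  rw [stairCost_of_lt hij, edgeCost, if_neg hc]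
  gcongr
  exact min_le_left _ _

theorem stairCost_le_right {i j : ℕ} (hij : i < j) (hc : c i ≠ c j) :
    stairCost x c M i j ≤ x j - x i + stairCost x c M i (j - 1) := by
  rw [stairCost_of_lt hij, edgeCost, if_neg hc]
  gcongr
  exact min_le_right _ _

/-- The optimum over chains is a lower bound for connected non-crossing bichromatic edge sets. -/
theorem IsChainTable.le_sum {F : ℕ → ℝ} {p : ℕ → ℕ} (hc : ∀ i, c i < 2)
    (hx : MonotoneOn x (Set.Iio n)) (h : IsChainTable (stairCost x c M) M n F p) (hn : 0 < n)
    {E : Finset (ℕ × ℕ)} (hE : ∀ e ∈ E, e.1 < e.2 ∧ e.2 < n ∧ c e.1 ≠ c e.2) (hE' : NoCross E)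
    (hconn : ∀ u < n, EdgeJoined E 0 u) : F (n - 1) ≤ ∑ e ∈ E, (x e.2 - x e.1) := by
  have := exists_chain_le (T := stairCost x c M) hc hx stairCost_self
    (fun i j hij _ h => stairCost_le_left hij h) (fun i j hij _ h => stairCost_le_right hij h)
    _ 0 (n - 1) E le_rfl (Nat.zero_le _) (by omega)
    (fun e he => ⟨Nat.zero_le _, (hE e he).1, by have := (hE e he).2.1; omega, (hE e he).2.2⟩) hE'
    (fun u _ hu => hconn u (by omega))
  have := this.table_le h (by omega)
  rwa [h.zero, zero_add] at this

/-! #### The optimum is smaller than the penalty -/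

variable {S : ℝ}

/-- The star at `i` is a staircase with `j - i` bichromatic edges, each of length at most `S`. -/
theorem stairCost_le_of_last (hS : ∀ i j, i ≤ j → j < n → x j - x i ≤ S) {i : ℕ} :
    ∀ j, i ≤ j → j < n → (∀ v, i < v → v ≤ j → c i ≠ c v) →
      stairCost x c M i j ≤ (j - i : ℕ) * S := by
  intro j hij
  induction j, hij using Nat.le_induction with
  | base => intro _ _; simp [stairCost_self]
  | succ j hij ih =>
    intro hj hcv
    have h1 := ih (by omega) fun v h1 h2 => hcv v h1 (by omega)
    have h2 := stairCost_le_right (x := x) (M := M) (by omega) (hcv (j + 1) (by omega) le_rfl)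
    have h3 := hS i (j + 1) (by omega) hj
    rw [Nat.add_sub_cancel] at h2
    rw [Nat.sub_add_comm hij]
    push_cast
    linarith

/-- Join the points up to `k` to `j` from left to right, then continue with the star at `k`. -/
theorem stairCost_le_of_first (hS : ∀ i j, i ≤ j → j < n → x j - x i ≤ S) {k j : ℕ} (hkj : k < j)
    (hj : j < n) (h1 : ∀ u v, u ≤ k → k < v → v ≤ j → c u ≠ c v) (d : ℕ) :
    d ≤ k → stairCost x c M (k - d) j ≤ (j - (k - d) : ℕ) * S := by
  induction d with
  | zero => 
    intro _
    exact stairCost_le_of_last hS j (by omega) hj fun v hv hv' => h1 _ v (by omega) (by omega) hv'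
  | succ d ih =>
    intro hd
    have h2 := ih (by omega)
    have h3 := stairCost_le_left (x := x) (M := M) (i := k - (d + 1)) (j := j) (by omega)
      (h1 _ _ (by omega) hkj le_rfl)
    have h4 := hS (k - (d + 1)) j (by omega) hj
    rw [show k - (d + 1) + 1 = k - d by omega] at h3
    rw [show j - (k - (d + 1)) = j - (k - d) + 1 by omega]
    push_cast
    linarith

/-- Let `m` be the last index before `j` whose colour differs from that of `j`. If both colours
occur up to `m`, add the star at `m` to the chain given by induction. Otherwise `[0, j]` consists of
two monochromatic runs, and one staircase suffices. The bound keeps the optimum below a penalty of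
`1 + n * S`. -/
theorem IsChainTable.le_mul {F : ℕ → ℝ} {p : ℕ → ℕ}
    (hS : ∀ i j, i ≤ j → j < n → x j - x i ≤ S)
    (h : IsChainTable (stairCost x c M) M n F p) {j : ℕ} (hj : j < n)
    (hex : ∃ u < j, c u ≠ c j) : F j ≤ j * S := by
  induction j using Nat.strong_induction_on with
  | _ j ih =>
    obtain ⟨m, hmj, hcm, hmax⟩ : ∃ m < j, c m ≠ c j ∧ ∀ u < j, c u ≠ c j → u ≤ m := by
      obtain ⟨u0, hu0, hu0'⟩ := hex
      have hs := Nat.findGreatest_spec (P := fun u => u < j ∧ c u ≠ c j) hu0.le ⟨hu0, hu0'⟩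
      exact ⟨_, hs.1, hs.2, fun u hu hu' => Nat.le_findGreatest hu.le ⟨hu, hu'⟩⟩
    have hrun : ∀ v, m < v → v ≤ j → c v = c j := by
      intro v hv hv'
      by_contra hcon
      rcases hv'.eq_or_lt with rfl | hlt
      · exact hcon rfl
      · have := hmax v hlt hcon; omega
    by_cases hex' : ∃ u < m, c u ≠ c m
    · have h1 := ih m hmj (by omega) hex'
      have h2 := h.le j hj m hmj
      have h3 := stairCost_le_of_last (M := M) hS (c := c) j hmj.le hj
        fun v hv hv' => by rw [hrun v hv hv']; exact hcm
      rw [Nat.cast_sub hmj.le] at h3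
      linarith
    · push Not at hex'
      have h1 := stairCost_le_of_first (M := M) (c := c) hS hmj hj
        (fun u v hu hv hv' => by
          rw [hrun v hv hv']
          rcases hu.eq_or_lt with rfl | hlt
          · exact hcm
          · rw [hex' u hlt]; exact hcm) m le_rfl
      have h2 := h.le j hj 0 (by omega)
      rw [h.zero] at h2
      simp only [Nat.sub_self, Nat.sub_zero] at h1
      linarith

end Weights

/-! ### Listing the edges of an optimal chain -/

/-- The state of the enumeration of the edges of an optimal chain: `E` lists the edges found so far,
what remains is a staircase on `[i, j]` and a chain on `[0, s]`. -/
structure EnumState (x : ℕ → ℝ) (c : ℕ → ℕ) (M : ℝ) (n : ℕ) (F : ℕ → ℝ) (E : List (ℕ × ℕ))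
    (i j s : ℕ) : Prop where
  le_left : s ≤ i
  le_right : i ≤ j
  lt : j < n
  weight : (E.map fun e => edgeCost x c M e.1 e.2).sum + stairCost x c M i j + F s = F (n - 1)
  length : E.length + (j - i) + s = n - 1
  mem : ∀ e ∈ E, s ≤ e.1 ∧ e.1 < e.2 ∧ e.2 < n ∧ (e.1 ≤ i ∧ j ≤ e.2 ∨ j ≤ e.1)
  noCross : NoCross E.toFinset
  joined : ∀ u < n, ∃ v, (v ≤ s ∨ i ≤ v ∧ v ≤ j) ∧ EdgeJoined E.toFinset u v
  joined_start : EdgeJoined E.toFinset s i ∨ EdgeJoined E.toFinset s j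

section Enum

variable {x : ℕ → ℝ} {c : ℕ → ℕ} {M : ℝ} {n : ℕ} {F : ℕ → ℝ} {p : ℕ → ℕ} {E : List (ℕ × ℕ)}
  {i j s : ℕ}

/-- By `mem`, every earlier edge encloses `[i, j]` or lies to its right, so it cannot interleave
with `(i, j)`. -/
theorem EnumState.noCross_append (h : EnumState x c M n F E i j s) :
    NoCross (E ++ [(i, j)]).toFinset := by
  intro e he f hf
  simp only [List.toFinset_append, Finset.mem_union, List.mem_toFinset, List.mem_singleton]
    at he hf
  rcases he with he | rfl <;> rcases hf with hf | rfl
  · exact h.noCross e (by simpa using he) f (by simpa using hf)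
  · have := h.mem e he; simp only; omega
  · have := h.mem f hf; simp only; omega
  · simp

/-- The index `i` may be dropped because the new edge joins it to `j`, which stays. This transfers
both `joined` and `joined_start`. -/
theorem EnumState.step_left (h : EnumState x c M n F E i j s) (hij : i < j)
    (hle : stairCost x c M (i + 1) j ≤ stairCost x c M i (j - 1)) :
    EnumState x c M n F (E ++ [(i, j)]) (i + 1) j s := by
  have hsub : E.toFinset ⊆ (E ++ [(i, j)]).toFinset := by
    rw [List.toFinset_append]; exact Finset.subset_union_left
  have hnew : EdgeJoined (E ++ [(i, j)]).toFinset i j := .of_mem (by simp)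
  refine ⟨by have := h.le_left; omega, hij, h.lt, ?_, ?_, ?_, h.noCross_append, ?_, ?_⟩
  · rw [← h.weight, stairCost_of_lt hij, min_eq_left hle]
    simp only [List.map_append, List.sum_append, List.map_cons, List.map_nil, List.sum_cons,
      List.sum_nil]
    ring
  · have := h.length; simp only [List.length_append, List.length_singleton]; omega
  · intro e he
    rcases List.mem_append.1 he with he | he
    · have := h.mem e he; omega
    · obtain rfl := List.mem_singleton.1 he
      have := h.le_left; have := h.lt
      simp only; omega
  · intro u hu
    obtain ⟨v, hv, huv⟩ := h.joined u hu
    by_cases hvi : v = i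
    · subst hvi
      exact ⟨j, by omega, (huv.mono hsub).trans hnew⟩
    · exact ⟨v, by omega, huv.mono hsub⟩
  · right
    rcases h.joined_start with h | h
    · exact (h.mono hsub).trans hnew
    · exact h.mono hsub

theorem EnumState.step_right (h : EnumState x c M n F E i j s) (hij : i < j)
    (hle : stairCost x c M i (j - 1) ≤ stairCost x c M (i + 1) j) :
    EnumState x c M n F (E ++ [(i, j)]) i (j - 1) s := by
  have hsub : E.toFinset ⊆ (E ++ [(i, j)]).toFinset := by
    rw [List.toFinset_append]; exact Finset.subset_union_left
  have hnew : EdgeJoined (E ++ [(i, j)]).toFinset i j := .of_mem (by simp)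
  refine ⟨h.le_left, by omega, by have := h.lt; omega, ?_, ?_, ?_, h.noCross_append, ?_, ?_⟩
  · rw [← h.weight, stairCost_of_lt hij, min_eq_right hle]
    simp only [List.map_append, List.sum_append, List.map_cons, List.map_nil, List.sum_cons,
      List.sum_nil]
    ring
  · have := h.length; simp only [List.length_append, List.length_singleton]; omega
  · intro e he
    rcases List.mem_append.1 he with he | he
    · have := h.mem e he; omega
    · obtain rfl := List.mem_singleton.1 he
      have := h.le_left; have := h.lt
      simp only; omega
  · intro u hu
    obtain ⟨v, hv, huv⟩ := h.joined u hu
    by_cases hvj : v = j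
    · subst hvj
      exact ⟨i, by omega, (huv.mono hsub).trans hnew.symm⟩
    · exact ⟨v, by omega, huv.mono hsub⟩
  · left
    rcases h.joined_start with h | h
    · exact h.mono hsub
    · exact (h.mono hsub).trans hnew.symm

theorem EnumState.weight_nonneg (h : EnumState x c M n F E i j s) (hx : MonotoneOn x (Set.Iio n))
    (hM : 0 ≤ M) : 0 ≤ (E.map fun e => edgeCost x c M e.1 e.2).sum := by
  refine List.sum_nonneg fun y hy => ?_
  obtain ⟨e, he, rfl⟩ := List.mem_map.1 hy
  have := h.mem e he
  exact edgeCost_nonneg hx hM this.2.1.le this.2.2.1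

/-- When a staircase is finished, the enumeration continues with its predecessor. -/
theorem EnumState.next (h : EnumState x c M n F E i i s) (hx : MonotoneOn x (Set.Iio n))
    (hM : 0 ≤ M) (hF : IsChainTable (stairCost x c M) M n F p) (hlt : F (n - 1) < M) :
    EnumState x c M n F E (p s) s (p s) ∧ (0 < s → p s < s) := by
  -- All listed costs are nonnegative, so `F s ≤ F (n - 1) < M` and the entry at `s > 0` has a
  -- genuine predecessor. At `s = 0` the convention `p 0 = 0` gives the empty staircase.
  have hp : F s = F (p s) + stairCost x c M (p s) s ∧ p s ≤ s ∧ (0 < s → p s < s) := by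
    rcases Nat.eq_zero_or_pos s with rfl | hs
    · simp [hF.pred_zero, hF.zero, stairCost_self]
    · have hFs : F s < M := by
        have h1 := h.weight
        have h2 := h.weight_nonneg hx hM
        rw [stairCost_self] at h1
        linarith
      rcases hF.pred s (h.le_left.trans_lt h.lt) hs with h1 | ⟨h1, h2⟩
      · exact absurd h1 hFs.ne
      · exact ⟨h2, h1.le, fun _ => h1⟩
  refine ⟨⟨le_rfl, hp.2.1, h.le_left.trans_lt h.lt, ?_, ?_, ?_, h.noCross, ?_, .inl (.refl _)⟩,
    hp.2.2⟩
  · have := h.weight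
    rw [stairCost_self] at this
    linarith [hp.1]
  · have := h.length; omega
  · intro e he
    have := h.mem e he
    omega
  · intro u hu
    obtain ⟨v, hv, huv⟩ := h.joined u hu
    by_cases hvs : v ≤ s
    · exact ⟨v, by omega, huv⟩
    -- The last point of the finished staircase drops out; `joined_start` ties it to `s`, where the
    -- next staircase ends.
    · obtain rfl : v = i := by omega
      refine ⟨s, by omega, huv.trans ?_⟩
      rcases h.joined_start with h | h <;> exact h.symm

theorem EnumState.start (hF : IsChainTable (stairCost x c M) M n F p) (hlt : F (n - 1) < M)
    (hn : 1 < n) : EnumState x c M n F [] (p (n - 1)) (n - 1) (p (n - 1)) ∧ p (n - 1) < n - 1 := by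
  rcases hF.pred (n - 1) (by omega) (by omega) with h | ⟨h1, h2⟩
  · exact absurd h hlt.ne
  · refine ⟨⟨le_rfl, h1.le, by omega, ?_, ?_, by simp, ?_, ?_, .inl (.refl _)⟩, h1⟩
    · simp only [List.map_nil, List.sum_nil]; linarith
    · simp only [List.length_nil]; omega
    · intro e he; simp at he
    · exact fun u hu => ⟨u, by omega, .refl u⟩

end Enum

/-! ### From index pairs to trees on the points -/

/-- `x 0 < … < x (n - 1)` are the points of `R ∪ B`, and `c` is `0` on red and `1` on blue ones. -/
structure IsSortedColoring (R B : Finset ℝ) (n : ℕ) (x : ℕ → ℝ) (c : ℕ → ℕ) : Prop where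
  strictMono : StrictMonoOn x (Set.Iio n)
  lt_two : ∀ i, c i < 2
  red : ∀ i < n, c i = 0 → x i ∈ R
  blue : ∀ i < n, c i = 1 → x i ∈ B
  surj : ∀ z ∈ R ∪ B, ∃ i < n, x i = z

/-- The edge between the points with indices `e.1` and `e.2`, red endpoint first. -/
def orientEdge (x : ℕ → ℝ) (c : ℕ → ℕ) (e : ℕ × ℕ) : ℝ × ℝ :=
  if c e.1 = 0 then (x e.1, x e.2) else (x e.2, x e.1)

theorem arcAbove_orientEdge (x : ℕ → ℝ) (c : ℕ → ℕ) (e : ℕ × ℕ) (h : ℝ) :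
    arcAbove (orientEdge x c e).1 (orientEdge x c e).2 h = arcAbove (x e.1) (x e.2) h := by
  unfold orientEdge
  split_ifs
  · rfl
  · exact arcAbove_comm _ _ _

section Transfer

variable {R B : Finset ℝ} {n : ℕ} {x : ℕ → ℝ} {c : ℕ → ℕ}

theorem IsSortedColoring.lt_iff (h : IsSortedColoring R B n x c) {i j : ℕ} (hi : i < n)
    (hj : j < n) : x i < x j ↔ i < j :=
  h.strictMono.lt_iff_lt (Set.mem_Iio.2 hi) (Set.mem_Iio.2 hj)

theorem IsSortedColoring.eq_iff (h : IsSortedColoring R B n x c) {i j : ℕ} (hi : i < n)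
    (hj : j < n) : x i = x j ↔ i = j :=
  h.strictMono.injOn.eq_iff (Set.mem_Iio.2 hi) (Set.mem_Iio.2 hj)

theorem IsSortedColoring.red_iff (h : IsSortedColoring R B n x c) (hd : Disjoint R B) {i : ℕ}
    (hi : i < n) : x i ∈ R ↔ c i = 0 := by
  refine ⟨fun hR => ?_, h.red i hi⟩
  have := h.lt_two i
  by_contra hne
  exact Finset.disjoint_left.1 hd hR (h.blue i hi (by omega))

theorem IsSortedColoring.blue_iff (h : IsSortedColoring R B n x c) (hd : Disjoint R B) {i : ℕ}
    (hi : i < n) : x i ∈ B ↔ c i = 1 := by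
  refine ⟨fun hB => ?_, h.blue i hi⟩
  have := h.lt_two i
  by_contra hne
  exact Finset.disjoint_right.1 hd hB (h.red i hi (by omega))

theorem IsSortedColoring.mem_union (h : IsSortedColoring R B n x c) {i : ℕ} (hi : i < n) :
    x i ∈ R ∪ B := by
  have := h.lt_two i
  rcases Nat.eq_zero_or_pos (c i) with h0 | h0
  · exact Finset.mem_union_left _ (h.red i hi h0)
  · exact Finset.mem_union_right _ (h.blue i hi (by omega))

theorem IsSortedColoring.card (h : IsSortedColoring R B n x c) : (R ∪ B).card = n := by
  have : R ∪ B = (Finset.range n).image x := by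
    ext z
    rw [Finset.mem_image]
    constructor
    · intro hz
      obtain ⟨i, hi, rfl⟩ := h.surj z hz
      exact ⟨i, Finset.mem_range.2 hi, rfl⟩
    · rintro ⟨i, hi, rfl⟩
      exact h.mem_union (Finset.mem_range.1 hi)
  rw [this, Finset.card_image_of_injOn, Finset.card_range]
  intro i hi j hj hij
  simp only [Finset.coe_range, Set.mem_Iio] at hi hj
  exact (h.eq_iff hi hj).1 hij

/-- Both index pairs are increasing, so equal images cannot come from opposite orientations. -/
theorem IsSortedColoring.orientEdge_inj (h : IsSortedColoring R B n x c) {e f : ℕ × ℕ}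
    (he : e.1 < e.2) (hen : e.2 < n) (hf : f.1 < f.2) (hfn : f.2 < n)
    (hef : orientEdge x c e = orientEdge x c f) : e = f := by
  unfold orientEdge at hef
  split_ifs at hef <;> rw [Prod.mk.injEq, h.eq_iff (by omega) (by omega),
    h.eq_iff (by omega) (by omega)] at hef
  · exact Prod.ext hef.1 hef.2
  · omega
  · omega
  · exact Prod.ext hef.2 hef.1

theorem IsSortedColoring.dist_orientEdge (h : IsSortedColoring R B n x c) {e : ℕ × ℕ}
    (he : e.1 < e.2) (hen : e.2 < n) :
    dist (linePoint (orientEdge x c e).1) (linePoint (orientEdge x c e).2) = x e.2 - x e.1 := by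
  have := (h.lt_iff (by omega) hen).2 he
  rw [dist_linePoint]
  unfold orientEdge
  split_ifs
  · rw [abs_sub_comm, abs_of_pos (by linarith)]
  · rw [abs_of_pos (by linarith)]

/-- The optimum over chains is a lower bound for the weight of a tree. -/
theorem IsChainTable.le_treeWeight {M : ℝ} {F : ℕ → ℝ} {p : ℕ → ℕ}
    (hF : IsChainTable (stairCost x c M) M n F p) (h : IsSortedColoring R B n x c)
    (hd : Disjoint R B) (hn : 0 < n) {T : Finset (ℝ × ℝ)} (hT : IsNonCrossingSpanningTree R B T) :
    F (n - 1) ≤ treeWeight T := by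
  classical
  set E := (Finset.range n ×ˢ Finset.range n).filter
    fun e => e.1 < e.2 ∧ orientEdge x c e ∈ T with hE
  have memE : ∀ e, e ∈ E ↔ e.1 < e.2 ∧ e.2 < n ∧ orientEdge x c e ∈ T := by
    intro e
    simp only [hE, Finset.mem_filter, Finset.mem_product, Finset.mem_range]
    constructor
    · rintro ⟨⟨-, h1⟩, h2, h3⟩; exact ⟨h2, h1, h3⟩
    · rintro ⟨h1, h2, h3⟩; exact ⟨⟨h1.trans h2, h2⟩, h1, h3⟩
  have inj : ∀ e ∈ E, ∀ f ∈ E, orientEdge x c e = orientEdge x c f → e = f := fun e he f hf =>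
    h.orientEdge_inj ((memE e).1 he).1 ((memE e).1 he).2.1 ((memE f).1 hf).1 ((memE f).1 hf).2.1
  have hsum : ∑ e ∈ E, (x e.2 - x e.1) ≤ treeWeight T := by
    unfold treeWeight
    rw [← Finset.sum_congr rfl fun e he => h.dist_orientEdge ((memE e).1 he).1 ((memE e).1 he).2.1,
      ← Finset.sum_image (f := fun e : ℝ × ℝ => dist (linePoint e.1) (linePoint e.2)) inj]
    -- For a lower bound it is enough that the index edges give some of the edges of `T`.
    refine Finset.sum_le_sum_of_subset_of_nonneg ?_ fun _ _ _ => dist_nonneg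
    intro e he
    obtain ⟨f, hf, rfl⟩ := Finset.mem_image.1 he
    exact ((memE f).1 hf).2.2
  refine (hF.le_sum h.lt_two h.strictMono.monotoneOn hn ?_ ?_ ?_).trans hsum
  · intro e he
    obtain ⟨h1, h2, h3⟩ := (memE e).1 he
    refine ⟨h1, h2, ?_⟩
    have h4 := Finset.mem_product.1 (hT.bichromatic h3)
    unfold orientEdge at h4
    split_ifs at h4 with h0
    · rw [h.blue_iff hd h2] at h4
      omega
    · rw [h.red_iff hd h2] at h4
      omega
  · obtain ⟨H, hH⟩ := hT.nonCrossing
    intro e he f hf hcr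
    obtain ⟨h1, h2, h3⟩ := (memE e).1 he
    obtain ⟨k1, k2, k3⟩ := (memE f).1 hf
    have hne : orientEdge x c e ≠ orientEdge x c f := fun heq => by
      obtain rfl := inj e he f hf heq
      omega
    have hsub := hH _ h3 _ k3 hne
    rw [arcAbove_orientEdge, arcAbove_orientEdge] at hsub
    obtain ⟨q, hq, hpos⟩ := exists_mem_arcAbove_inter (H (orientEdge x c e)) (H (orientEdge x c f))
      ((h.lt_iff (by omega) (by omega)).2 hcr.1) ((h.lt_iff (by omega) (by omega)).2 hcr.2.1)
      ((h.lt_iff (by omega) (by omega)).2 hcr.2.2)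
    -- Shared points of two arcs are endpoints and lie on the line, but `q` lies strictly above it.
    rcases (hsub hq).1 with h | h
    all_goals
      rw [h, linePoint_apply_one] at hpos
      exact hpos.false
  · have key : ∀ a b, a < n → b < n → a ≠ b → (x a, x b) ∈ T → EdgeJoined E a b := by
      intro a b ha hb hab hmem
      have hcol := Finset.mem_product.1 (hT.bichromatic hmem)
      rw [h.red_iff hd ha, h.blue_iff hd hb] at hcol
      rcases lt_or_gt_of_ne hab with hlt | hlt
      · exact .of_mem ((memE _).2 ⟨hlt, hb, by simpa [orientEdge, hcol.1] using hmem⟩)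
      · exact (EdgeJoined.of_mem ((memE _).2
          ⟨hlt, ha, by simpa [orientEdge, hcol.2] using hmem⟩)).symm
    have reach : ∀ v w, (edgeGraph R B T).Reachable v w → ∀ a b, a < n → b < n → x a = v.1 →
        x b = w.1 → EdgeJoined E a b := by
      intro v w hvw
      rw [SimpleGraph.reachable_iff_reflTransGen] at hvw
      induction hvw with
      | refl =>
        intro a b ha hb h1 h2
        obtain rfl := (h.eq_iff ha hb).1 (h1.trans h2.symm)
        exact .refl _
      | @tail y w _ hadj ih =>
        intro a b ha hb h1 h2
        obtain ⟨d, hdn, hd'⟩ := h.surj y.1 y.2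
        refine (ih a d ha hdn h1 hd').trans ?_
        rw [edgeGraph, SimpleGraph.fromRel_adj, ← hd', ← h2] at hadj
        have hdb : d ≠ b := by
          rintro rfl
          exact hadj.1 (Subtype.ext (hd'.symm.trans h2))
        rcases hadj.2 with hm | hm
        · exact key d b hdn hb hdb hm
        · exact (key b d hb hdn hdb.symm hm).symm
    intro u hu
    exact reach ⟨x 0, h.mem_union hn⟩ ⟨x u, h.mem_union hu⟩ (hT.isTree.connected _ _) 0 u hn hu
      rfl rfl

theorem mem_edgeEnds_orientEdge (x : ℕ → ℝ) (c : ℕ → ℕ) (e : ℕ × ℕ)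
    {q : EuclideanSpace ℝ (Fin 2)} (hq : q 1 = 0) (he : q 0 = x e.1 ∨ q 0 = x e.2) :
    q ∈ edgeEnds (orientEdge x c e) := by
  unfold edgeEnds orientEdge
  rw [Set.mem_insert_iff, Set.mem_singleton_iff, eq_linePoint_iff, eq_linePoint_iff]
  split_ifs
  · exact he.imp (fun h => ⟨h, hq⟩) fun h => ⟨h, hq⟩
  · exact he.symm.imp (fun h => ⟨h, hq⟩) fun h => ⟨h, hq⟩

/-- Edges without interleaving endpoints can be drawn as semicircles. -/
theorem IsSortedColoring.isNonCrossing (h : IsSortedColoring R B n x c) {E : List (ℕ × ℕ)}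
    (hE : ∀ e ∈ E, e.1 < e.2 ∧ e.2 < n) (hn : NoCross E.toFinset) :
    IsNonCrossing (E.map (orientEdge x c)).toFinset := by
  refine ⟨fun _ => 0, ?_⟩
  intro e he0 f hf0 hne q hq
  obtain ⟨e, he, rfl⟩ := List.mem_map.1 (List.mem_toFinset.1 he0)
  obtain ⟨f, hf, rfl⟩ := List.mem_map.1 (List.mem_toFinset.1 hf0)
  have h1 := hE e he
  have h2 := hE f hf
  have n1 := hn e (List.mem_toFinset.2 he) f (List.mem_toFinset.2 hf)
  have n2 := hn f (List.mem_toFinset.2 hf) e (List.mem_toFinset.2 he)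
  rw [arcAbove_orientEdge, arcAbove_orientEdge] at hq
  have := semicircle_inter ((h.lt_iff (by omega) (by omega)).2 h1.1)
    ((h.lt_iff (by omega) (by omega)).2 h2.1)
    (fun heq => by
      rw [Prod.mk.injEq, h.eq_iff (by omega) (by omega), h.eq_iff (by omega) (by omega)] at heq
      exact hne (congrArg _ (Prod.ext heq.1 heq.2)))
    (by rwa [h.lt_iff (by omega) (by omega), h.lt_iff (by omega) (by omega),
      h.lt_iff (by omega) (by omega)])
    (by rwa [h.lt_iff (by omega) (by omega), h.lt_iff (by omega) (by omega),
      h.lt_iff (by omega) (by omega)]) hq.1 hq.2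
  exact ⟨mem_edgeEnds_orientEdge x c e this.1 this.2.1,
    mem_edgeEnds_orientEdge x c f this.1 this.2.2⟩

/-- A completed enumeration lists the edges of an optimal tree. -/
theorem EnumState.isOptimal {M : ℝ} {F : ℕ → ℝ} {p : ℕ → ℕ} {E : List (ℕ × ℕ)} {i s : ℕ}
    (hE : EnumState x c M n F E i 0 s) (hF : IsChainTable (stairCost x c M) M n F p)
    (h : IsSortedColoring R B n x c) (hd : Disjoint R B) (hM : 0 ≤ M) (hlt : F (n - 1) < M) :
    (E.map (orientEdge x c)).Nodup ∧
      IsOptimalNonCrossingSpanningTree R B (E.map (orientEdge x c)).toFinset := by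
  classical
  obtain rfl : i = 0 := Nat.le_zero.1 hE.le_right
  obtain rfl : s = 0 := Nat.le_zero.1 hE.le_left
  have hn : 0 < n := hE.lt
  have hmono := h.strictMono.monotoneOn
  have hweight := hE.weight
  rw [stairCost_self, hF.zero, add_zero, add_zero] at hweight
  have hlen := hE.length
  simp only [Nat.sub_zero, add_zero] at hlen
  -- The costs are nonnegative and add up to less than `M`, so no penalty was paid.
  have hcol : ∀ e ∈ E, c e.1 ≠ c e.2 := by
    intro e he hce
    have hle : edgeCost x c M e.1 e.2 ≤ (E.map fun e => edgeCost x c M e.1 e.2).sum := by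
      refine List.single_le_sum (fun y hy => ?_) _ (List.mem_map.2 ⟨e, he, rfl⟩)
      obtain ⟨f, hf, rfl⟩ := List.mem_map.1 hy
      have := hE.mem f hf
      exact edgeCost_nonneg hmono hM this.2.1.le this.2.2.1
    rw [edgeCost, if_pos hce] at hle
    linarith
  obtain ⟨φ, hφ⟩ : ∃ φ : ℕ → {z : ℝ // z ∈ R ∪ B}, ∀ u < n, (φ u).1 = x u := by
    refine ⟨fun u => if hu : u < n then ⟨x u, h.mem_union hu⟩ else ⟨x 0, h.mem_union hn⟩, ?_⟩
    intro u hu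
    simp [hu]
  set L := E.map (orientEdge x c) with hL
  have memL : ∀ e, e ∈ L.toFinset ↔ ∃ f ∈ E, orientEdge x c f = e := by
    intro e; rw [List.mem_toFinset, hL, List.mem_map]
  have hadj : ∀ e ∈ E, (edgeGraph R B L.toFinset).Adj (φ e.1) (φ e.2) := by
    intro e he
    have h1 := hE.mem e he
    have hmem : orientEdge x c e ∈ L.toFinset := (memL _).2 ⟨e, he, rfl⟩
    rw [edgeGraph, SimpleGraph.fromRel_adj, hφ _ (by omega), hφ _ (by omega)]
    refine ⟨fun heq => ?_, ?_⟩
    · have := congrArg Subtype.val heq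
      rw [hφ _ (by omega), hφ _ (by omega), h.eq_iff (by omega) (by omega)] at this
      omega
    · unfold orientEdge at hmem
      split_ifs at hmem
      · exact .inl hmem
      · exact .inr hmem
  have hreach : ∀ u v, EdgeJoined E.toFinset u v →
      (edgeGraph R B L.toFinset).Reachable (φ u) (φ v) := by
    intro u v huv
    induction huv with
    | rel u v huv => exact (hadj _ (List.mem_toFinset.1 huv)).reachable
    | refl u => exact .refl _
    | symm u v _ ih => exact ih.symm
    | trans u v w _ _ ih1 ih2 => exact ih1.trans ih2
  have hto0 : ∀ v, (edgeGraph R B L.toFinset).Reachable v (φ 0) := by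
    intro v
    obtain ⟨a, ha, hav⟩ := h.surj v.1 v.2
    obtain rfl : φ a = v := Subtype.ext ((hφ a ha).trans hav)
    obtain ⟨w, hw, haw⟩ := hE.joined a ha
    obtain rfl : w = 0 := by omega
    exact hreach _ _ haw
  have hconn : (edgeGraph R B L.toFinset).Connected :=
    { preconnected := fun v w => (hto0 v).trans (hto0 w).symm
      nonempty := ⟨φ 0⟩ }
  have hcardV : Nat.card {z : ℝ // z ∈ R ∪ B} = n := by
    rw [Nat.card_eq_fintype_card, Fintype.card_coe, h.card]
  have hedge : (edgeGraph R B L.toFinset).edgeSet ⊆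
      (E.toFinset.image fun e => s(φ e.1, φ e.2) : Finset _) := by
    intro q
    induction q using Sym2.ind with
    | _ v w =>
      have key : ∀ v w : {z : ℝ // z ∈ R ∪ B}, (v.1, w.1) ∈ L.toFinset →
          ∃ e ∈ E, s(φ e.1, φ e.2) = s(v, w) := by
        intro v w hvw
        obtain ⟨f, hf, hfe⟩ := (memL _).1 hvw
        have h1 := hE.mem f hf
        refine ⟨f, hf, ?_⟩
        unfold orientEdge at hfe
        split_ifs at hfe <;> rw [Prod.mk.injEq] at hfe
        · rw [show φ f.1 = v from Subtype.ext ((hφ _ (by omega)).trans hfe.1),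
            show φ f.2 = w from Subtype.ext ((hφ _ (by omega)).trans hfe.2)]
        · rw [show φ f.1 = w from Subtype.ext ((hφ _ (by omega)).trans hfe.2),
            show φ f.2 = v from Subtype.ext ((hφ _ (by omega)).trans hfe.1), Sym2.eq_swap]
      intro hvw
      rw [SimpleGraph.mem_edgeSet, edgeGraph, SimpleGraph.fromRel_adj] at hvw
      simp only [Finset.coe_image, Set.mem_image, Finset.mem_coe, List.mem_toFinset]
      rcases hvw.2 with hm | hm
      · exact key v w hm
      · obtain ⟨e, he, heq⟩ := key w v hm
        exact ⟨e, he, heq.trans Sym2.eq_swap⟩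
  have hcardE : Nat.card (edgeGraph R B L.toFinset).edgeSet ≤ E.toFinset.card := by
    rw [Nat.card_coe_set_eq]
    refine (Set.ncard_le_ncard hedge (Finset.finite_toSet _)).trans ?_
    rw [Set.ncard_coe_finset]
    exact Finset.card_image_le
  have hcardlen : E.toFinset.card ≤ E.length := List.toFinset_card_le E
  -- A connected graph on `n` vertices has at least `n - 1` edges, and the list has length `n - 1`.
  -- Hence nothing is repeated and the graph is a tree.
  have hge := hconn.card_vert_le_card_edgeSet_add_one
  rw [hcardV] at hge
  have hnodupE : E.Nodup := by
    rw [← Multiset.coe_nodup, ← Multiset.toFinset_card_eq_card_iff_nodup]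
    have : E.toFinset.card = E.length := by omega
    exact this
  have hnodup : L.Nodup := by
    refine (List.nodup_map_iff_inj_on hnodupE).2 fun e he f hf hef => ?_
    have h1 := hE.mem e he
    have h2 := hE.mem f hf
    exact h.orientEdge_inj h1.2.1 h1.2.2.1 h2.2.1 h2.2.2.1 hef
  have htree : IsNonCrossingSpanningTree R B L.toFinset := by
    refine ⟨?_, ?_, ?_⟩
    · intro e he
      obtain ⟨f, hf, rfl⟩ := (memL _).1 he
      have h1 := hE.mem f hf
      have h2 := hcol f hf
      have h3 := h.lt_two f.1
      have h4 := h.lt_two f.2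
      unfold orientEdge
      split_ifs
      · exact Finset.mem_product.2 ⟨h.red _ (by omega) (by omega), h.blue _ (by omega) (by omega)⟩
      · exact Finset.mem_product.2 ⟨h.red _ (by omega) (by omega), h.blue _ (by omega) (by omega)⟩
    · rw [SimpleGraph.isTree_iff_connected_and_card]
      refine ⟨hconn, ?_⟩
      rw [hcardV]
      omega
    · exact h.isNonCrossing (fun e he => ⟨(hE.mem e he).2.1, (hE.mem e he).2.2.1⟩) hE.noCross
  refine ⟨hnodup, htree, fun T' hT' => ?_⟩
  refine le_trans (le_of_eq ?_) (hF.le_treeWeight h hd hn hT')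
  rw [← hweight, treeWeight, List.sum_toFinset _ hnodup, hL, List.map_map]
  refine congrArg List.sum (List.map_congr_left fun e he => ?_)
  have h1 := hE.mem e he
  rw [Function.comp_apply, h.dist_orientEdge h1.2.1 h1.2.2.1, edgeCost, if_neg (hcol e he)]

end Transfer

/-! ### Running programs within a time bound -/

namespace RealRAM

/-- Started in `σ`, the program halts after at most `t` steps in a memory that satisfies `Q`. -/
def Ends (p : Program) (σ : State) (t : ℕ) (Q : State → Prop) : Prop :=
  ∃ k ≤ t, ∃ τ, Run p σ k τ ∧ Q τ

/-- The memory after a sequence of elementary instructions. -/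
noncomputable def exec (l : List Instr) (σ : State) : State := l.foldl (fun σ c => c.apply σ) σ

/-- A sequence of elementary instructions as a program. -/
def block (l : List Instr) : Program := l.foldr (fun c p => .seq (.instr c) p) .skip

section Logic

variable {p q : Program} {σ : State} {t u : ℕ} {Q Q' : State → Prop}

theorem Ends.mono (h : Ends p σ t Q) (htu : t ≤ u) (hQ : ∀ τ, Q τ → Q' τ) : Ends p σ u Q' := by
  obtain ⟨k, hk, τ, hr, hτ⟩ := h
  exact ⟨k, hk.trans htu, τ, hr, hQ τ hτ⟩

theorem Ends.le (h : Ends p σ t Q) (htu : t ≤ u) : Ends p σ u Q := h.mono htu fun _ h => h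

theorem Ends.skip (h : Q σ) : Ends .skip σ 0 Q := ⟨0, le_rfl, σ, .skip σ, h⟩

theorem Ends.seq (h : Ends p σ t fun τ => Ends q τ u Q) : Ends (.seq p q) σ (t + u) Q := by
  obtain ⟨k, hk, τ, hr, k', hk', υ, hr', hυ⟩ := h
  exact ⟨k + k', add_le_add hk hk', υ, .seq hr hr', hυ⟩

theorem Ends.ite {b : Test} (h : b.Holds σ → Ends p σ t Q) (h' : ¬ b.Holds σ → Ends q σ t Q) :
    Ends (.ite b p q) σ (t + 1) Q := by
  by_cases hb : b.Holds σ
  · obtain ⟨k, hk, τ, hr, hτ⟩ := h hb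
    exact ⟨k + 1, by omega, τ, .ite_true hb hr, hτ⟩
  · obtain ⟨k, hk, τ, hr, hτ⟩ := h' hb
    exact ⟨k + 1, by omega, τ, .ite_false hb hr, hτ⟩

theorem Ends.block {l : List Instr} (h : Q (exec l σ)) : Ends (block l) σ l.length Q := by
  induction l generalizing σ with
  | nil => exact .skip h
  | cons c l ih =>
    have : Ends (.seq (.instr c) (RealRAM.block l)) σ (1 + l.length) Q :=
      .seq ⟨1, le_rfl, _, .instr c σ, ih h⟩
    exact this.mono (by simp [add_comm]) fun _ h => h

/-- A loop whose invariant `I k` bounds the number of remaining iterations by `k`. -/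
theorem Ends.loop {b : Test} (I : ℕ → State → Prop)
    (h : ∀ k σ, I k σ → (¬ b.Holds σ ∧ Q σ) ∨
      (b.Holds σ ∧ ∃ k', k = k' + 1 ∧ Ends p σ t (I k'))) :
    ∀ k σ, I k σ → Ends (.loop b p) σ (k * (t + 1) + 1) Q := by
  intro k
  induction k with
  | zero =>
    intro σ hI
    rcases h 0 σ hI with ⟨hb, hQ⟩ | ⟨_, k', hk', _⟩
    · exact ⟨1, by omega, σ, .loop_false hb, hQ⟩
    · omega
  | succ k ih =>
    intro σ hI
    rcases h _ σ hI with ⟨hb, hQ⟩ | ⟨hb, k', hk', m, hm, τ, hr, hτ⟩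
    · exact ⟨1, by omega, σ, .loop_false hb, hQ⟩
    · obtain rfl : k = k' := by omega
      obtain ⟨m', hm', υ, hr', hυ⟩ := ih τ hτ
      exact ⟨m + m' + 1, by rw [Nat.succ_mul]; omega, υ, .loop_true hb hr hr', hυ⟩

end Logic

end RealRAM

namespace RealRAM

/-! ### Collecting and sorting the points -/

/-- Append the blue points to the red ones in real array `0`. -/
def concatProgram : Program :=
  .seq (block [.nconst 3 1, .nmove 4 0, .nconst 5 0])
    (.loop (.nlt 5 1) (block [.rload 0 1 5, .rstore 0 4 0, .nadd 4 4 3, .nadd 5 5 3]))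

/-- The first `n` cells of real array `0` hold `z`, the first `r` of them being red points. -/
structure HoldsPoints (r n : ℕ) (z : ℕ → ℝ) (σ : State) : Prop where
  red_count : σ.nreg 0 = r
  out_count : σ.nreg 2 = 0
  one : σ.nreg 3 = 1
  count : σ.nreg 4 = n
  zero : σ.nreg 8 = 0
  points : ∀ i < n, σ.rarr 0 i = z i
  colors : ∀ i, σ.narr 0 i < 2
  pred : σ.narr 2 0 = 0
  stair : σ.rarr 6 0 = 0
  table : σ.rarr 7 0 = 0

theorem HoldsPoints.congr {r n : ℕ} {z : ℕ → ℝ} {σ τ : State} (h : HoldsPoints r n z σ)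
    (h0 : τ.nreg 0 = σ.nreg 0 := by simp [exec, Instr.apply])
    (h2 : τ.nreg 2 = σ.nreg 2 := by simp [exec, Instr.apply])
    (h3 : τ.nreg 3 = σ.nreg 3 := by simp [exec, Instr.apply])
    (h4 : τ.nreg 4 = σ.nreg 4 := by simp [exec, Instr.apply])
    (h8 : τ.nreg 8 = σ.nreg 8 := by simp [exec, Instr.apply])
    (k0 : τ.rarr 0 = σ.rarr 0 := by simp [exec, Instr.apply])
    (k6 : τ.rarr 6 = σ.rarr 6 := by simp [exec, Instr.apply])
    (k7 : τ.rarr 7 = σ.rarr 7 := by simp [exec, Instr.apply])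
    (l0 : τ.narr 0 = σ.narr 0 := by simp [exec, Instr.apply])
    (l2 : τ.narr 2 = σ.narr 2 := by simp [exec, Instr.apply]) : HoldsPoints r n z τ :=
  ⟨h0 ▸ h.red_count, h2 ▸ h.out_count, h3 ▸ h.one, h4 ▸ h.count, h8 ▸ h.zero, k0 ▸ h.points,
    l0 ▸ h.colors, l2 ▸ h.pred, k6 ▸ h.stair, k7 ▸ h.table⟩

theorem concatProgram_ends (reds blues : List ℝ) :
    Ends concatProgram (inputState reds blues) (3 + (blues.length * 5 + 1))
      (HoldsPoints reds.length (reds.length + blues.length) fun i => (reds ++ blues).getD i 0) := by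
  refine .seq (.block (Ends.loop (fun k σ => σ.nreg 5 + k = blues.length ∧
    σ.nreg 1 = blues.length ∧ (∀ i, σ.rarr 1 i = blues.getD i 0) ∧
    HoldsPoints reds.length (reds.length + σ.nreg 5) (fun i => (reds ++ blues).getD i 0) σ)
    ?_ _ _ ?_))
  · rintro k σ ⟨h1, h2, h3, h⟩
    rcases k with _ | k
    · refine .inl ⟨?_, ?_⟩
      · simp only [Test.Holds]; omega
      · have h5 : σ.nreg 5 = blues.length := by omega
        rwa [h5] at h
    · refine .inr ⟨by simp only [Test.Holds]; omega, k, rfl, .block ⟨?_, ?_, ?_, ?_⟩⟩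
      · simp [exec, Instr.apply, h.one]; omega
      · simp [exec, Instr.apply, h2]
      · simpa [exec, Instr.apply] using h3
      · constructor
        case points =>
          intro i hi
          simp only [exec, List.foldl, Instr.apply, Function.update_apply] at hi ⊢
          simp [h.one] at hi
          simp only [h.count]
          by_cases hlt : i = reds.length + σ.nreg 5
          · subst hlt
            simp [h3, List.getElem?_append_right]
          · have := h.points i (by omega)
            simpa [hlt] using this
        all_goals simp [exec, Instr.apply, h.one, h.red_count, h.out_count, h.count, h.zero,
          h.colors, h.pred, h.stair, h.table]
        omega
  · refine ⟨?_, ?_, ?_, ?_⟩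
    · simp [exec, Instr.apply]
    · simp [exec, Instr.apply, inputState]
    · simp [exec, Instr.apply, inputState]
    · constructor
      case points =>
        intro i hi
        simp only [exec, List.foldl, Instr.apply, Function.update_apply] at hi ⊢
        simp at hi
        simp [inputState, List.getElem?_append_left hi]
      all_goals simp [exec, Instr.apply, inputState]

/-- Store the points in increasing order in real array `5` and their colours in array `0`. -/
def sortProgram : Program :=
  .seq (block [.nconst 5 0])
    (.loop (.nlt 5 4)
      (.seq (block [.rload 0 0 5, .nconst 6 0, .nconst 7 0])
        (.seq
          (.loop (.nlt 6 4)
            (.seq (block [.rload 1 0 6])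
              -- The second branch has no effect; it only has the same length as the first.
              (.seq (.ite (.rlt 1 0) (block [.nadd 7 7 3]) (block [.nmove 7 7]))
                (block [.nadd 6 6 3]))))
          (.seq (.ite (.nlt 5 0) (block [.nconst 9 0]) (block [.nconst 9 1]))
            (block [.rstore 5 7 0, .nstore 0 7 9, .nadd 5 5 3])))))

/-- The number of indices below `n` whose value under `z` is less than `v`. -/
noncomputable def countLess (z : ℕ → ℝ) (n : ℕ) (v : ℝ) : ℕ :=
  ((Finset.range n).filter fun a => z a < v).card

theorem countLess_succ (z : ℕ → ℝ) (n : ℕ) (v : ℝ) :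
    countLess z (n + 1) v = countLess z n v + if z n < v then 1 else 0 := by
  unfold countLess
  rw [Finset.range_add_one, Finset.filter_insert]
  split_ifs
  · rw [Finset.card_insert_of_notMem (by simp)]
  · rfl

theorem countLess_lt {z : ℕ → ℝ} {n i j : ℕ} (hi : i < n) (h : z i < z j) :
    countLess z n (z i) < countLess z n (z j) := by
  refine Finset.card_lt_card (Finset.ssubset_iff_of_subset ?_ |>.2 ⟨i, ?_, ?_⟩)
  · intro a ha
    rw [Finset.mem_filter] at ha ⊢
    exact ⟨ha.1, ha.2.trans h⟩
  · exact Finset.mem_filter.2 ⟨Finset.mem_range.2 hi, h⟩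
  · simp

theorem countLess_lt_self {z : ℕ → ℝ} {n i : ℕ} (hi : i < n) : countLess z n (z i) < n := by
  conv_rhs => rw [← Finset.card_range n]
  refine Finset.card_lt_card (Finset.ssubset_iff_of_subset (Finset.filter_subset _ _) |>.2
    ⟨i, Finset.mem_range.2 hi, ?_⟩)
  simp

/-- Distinct points have distinct ranks, so no cell is overwritten when each point is stored at its
rank. -/
theorem countLess_injOn {z : ℕ → ℝ} {n : ℕ} (hz : Set.InjOn z (Set.Iio n)) {i j : ℕ} (hi : i < n)
    (hj : j < n) (h : countLess z n (z i) = countLess z n (z j)) : i = j := by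
  by_contra hne
  have : z i ≠ z j := fun heq => hne (hz (Set.mem_Iio.2 hi) (Set.mem_Iio.2 hj) heq)
  rcases lt_or_gt_of_ne this with hlt | hlt
  · exact (countLess_lt hi hlt).ne h
  · exact (countLess_lt hj hlt).ne' h

/-- The points with indices below `m` are in place. -/
structure Sorting (r n : ℕ) (z : ℕ → ℝ) (m : ℕ) (σ : State) : Prop where
  holds : HoldsPoints r n z σ
  index : σ.nreg 5 = m
  placed : ∀ i < m, σ.rarr 5 (countLess z n (z i)) = z i ∧
    σ.narr 0 (countLess z n (z i)) = if i < r then 0 else 1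

theorem Sorting.insert {r n m : ℕ} {z : ℕ → ℝ} {σ : State} (hz : Set.InjOn z (Set.Iio n))
    (h : Sorting r n z m σ) (hm : m < n) (h0 : σ.rreg 0 = z m)
    (h7 : σ.nreg 7 = countLess z n (z m)) {b : ℕ} (hb : b = if m < r then 0 else 1) :
    Sorting r n z (m + 1)
      (exec [.rstore 5 7 0, .nstore 0 7 9, .nadd 5 5 3] (exec [.nconst 9 b] σ)) := by
  have hb2 : b < 2 := by split_ifs at hb <;> omega
  refine ⟨?_, ?_, ?_⟩
  · constructor
    case points => simpa [exec, Instr.apply] using h.holds.points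
    case colors =>
      intro i
      have : Function.update (σ.narr 0) (σ.nreg 7) b i < 2 := by
        rw [Function.update_apply]
        split_ifs
        · exact hb2
        · exact h.holds.colors i
      simpa [exec, Instr.apply] using this
    case pred => simp [exec, Instr.apply, h.holds.pred]
    all_goals simp [exec, Instr.apply, h.holds.one, h.holds.red_count, h.holds.out_count,
      h.holds.count, h.holds.zero, h.holds.stair, h.holds.table]
  · simp [exec, Instr.apply, h.index, h.holds.one]
  · intro i hi
    simp [exec, Instr.apply, Function.update_apply, h7, h0]
    rcases Nat.lt_succ_iff_lt_or_eq.1 hi with hlt | rfl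
    · have hne : countLess z n (z i) ≠ countLess z n (z m) := fun heq =>
        hlt.ne (countLess_injOn hz (by omega) hm heq)
      simpa [hne] using h.placed i hlt
    · simp [hb]

/-- Each rank is counted by one pass over all points; quadratic time allows this. -/
theorem sortProgram_ends {r n : ℕ} {z : ℕ → ℝ} (hz : Set.InjOn z (Set.Iio n)) {σ : State}
    (hσ : HoldsPoints r n z σ) :
    Ends sortProgram σ (1 + (n * (n * 5 + 9 + 1) + 1)) (Sorting r n z n) := by
  refine .seq (.block (Ends.loop (t := n * 5 + 9) (fun k σ => ∃ m, m + k = n ∧ Sorting r n z m σ) ?_ n _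
    ⟨0, by omega, hσ.congr, ?_, ?_⟩))
  · rintro k σ ⟨m, hm, h⟩
    rcases k with _ | k
    · obtain rfl : m = n := by omega
      refine .inl ⟨?_, h⟩
      simp [Test.Holds, h.index, h.holds.count]
    refine .inr ⟨by simp only [Test.Holds, h.index, h.holds.count]; omega, k, rfl, .le (.seq (u := n * 5 + 1 + 5) (.block
      (.seq (u := 5) ((Ends.loop (t := 4) (fun k' σ => ∃ a, a + k' = n ∧ Sorting r n z m σ ∧ σ.nreg 6 = a ∧
        σ.rreg 0 = z m ∧ σ.nreg 7 = countLess z a (z m)) (Q := fun σ => Sorting r n z m σ ∧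
          σ.rreg 0 = z m ∧ σ.nreg 7 = countLess z n (z m)) ?_ n _
          ⟨0, by omega, ⟨h.holds.congr, ?_, ?_⟩, ?_, ?_, ?_⟩).mono le_rfl ?_)))) ?_⟩
    · rintro k' σ ⟨a, ha, h, h6, h0, h7⟩
      rcases k' with _ | k'
      · obtain rfl : a = n := by omega
        refine .inl ⟨?_, h, h0, h7⟩
        simp [Test.Holds, h6, h.holds.count]
      refine .inr ⟨by simp only [Test.Holds, h6, h.holds.count]; omega, k', rfl,
        .le (.seq (u := 3) (.block (.seq (u := 1) (.ite (t := 1) (fun hb => .block (.block ?_))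
          (fun hb => .block (.block ?_)))))) (by simp)⟩
      all_goals
        have hza := h.holds.points a (by omega)
        simp [Test.Holds, exec, Instr.apply, h6, h0, hza] at hb
        refine ⟨a + 1, by omega, ⟨h.holds.congr, ?_, ?_⟩, ?_, ?_, ?_⟩
        · simp [exec, Instr.apply, h.index]
        · simpa [exec, Instr.apply] using h.placed
        · simp [exec, Instr.apply, h6, h.holds.one]
        · simp [exec, Instr.apply, h0]
        · simp [exec, Instr.apply, h7, h.holds.one, countLess_succ, hb]
    · simp [exec, Instr.apply, h.index]
    · simpa [exec, Instr.apply] using h.placed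
    · simp [exec, Instr.apply]
    · simp [exec, Instr.apply, h.index, h.holds.points m (by omega)]
    · simp [exec, Instr.apply, countLess]
    rotate_left
    · simp
      omega
    · rintro τ ⟨h, h0, h7⟩
      refine .seq (u := 3) (.ite (t := 1) (fun hb => .block (.block ⟨m + 1, by omega, ?_⟩))
        (fun hb => .block (.block ⟨m + 1, by omega, ?_⟩)))
      all_goals
        simp only [Test.Holds, h.index, h.holds.red_count] at hb
        exact h.insert hz (by omega) h0 h7 (by simp [hb])
  · simp [exec, Instr.apply]
  · intro i hi
    omega

end RealRAM

/-! ### Chain tables under extension, and the layout of the square table -/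

theorem IsChainTable.congr {T : ℕ → ℕ → ℝ} {M : ℝ} {n : ℕ} {F F' : ℕ → ℝ} {p p' : ℕ → ℕ}
    (h : IsChainTable T M n F p) (hn : 0 < n) (hF : ∀ b < n, F' b = F b)
    (hp : ∀ b < n, p' b = p b) : IsChainTable T M n F' p' := by
  refine ⟨by rw [hF 0 hn, h.zero], by rw [hp 0 hn, h.pred_zero], ?_, ?_⟩
  · intro j hj m hm
    rw [hF j hj, hF m (hm.trans hj)]
    exact h.le j hj m hm
  · intro j hj hj0
    rw [hF j hj, hp j hj]
    refine (h.pred j hj hj0).imp_right fun h' => ⟨h'.1, ?_⟩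
    rw [hF _ (h'.1.trans hj)]
    exact h'.2

/-- Entries below `n` do not refer to `n`, so only the two conditions at `n` itself have to be
checked. -/
theorem IsChainTable.extend {T : ℕ → ℕ → ℝ} {M : ℝ} {n : ℕ} {F : ℕ → ℝ} {p : ℕ → ℕ}
    (h : IsChainTable T M n F p) (hn : 0 < n) {v : ℝ} (hle : ∀ m < n, v ≤ F m + T m n)
    (hpred : v = M ∨ (p n < n ∧ v = F (p n) + T (p n) n)) :
    IsChainTable T M (n + 1) (Function.update F n v) p := by
  have hF : ∀ b < n, Function.update F n v b = F b := fun b hb =>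
    Function.update_of_ne hb.ne v F
  have h' := h.congr hn hF fun _ _ => rfl
  refine ⟨h'.zero, h'.pred_zero, ?_, ?_⟩
  · intro j hj m hm
    rcases Nat.lt_succ_iff_lt_or_eq.1 hj with hlt | rfl
    · exact h'.le j hlt m hm
    · rw [Function.update_self, hF m hm]
      exact hle m hm
  · intro j hj hj0
    rcases Nat.lt_succ_iff_lt_or_eq.1 hj with hlt | rfl
    · exact h'.pred j hlt hj0
    · rw [Function.update_self]
      refine hpred.imp_right fun h' => ⟨h'.1, ?_⟩
      rw [hF _ h'.1]
      exact h'.2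

/-- Column `b` uses only rows `a ≤ b < n`, so it ends before cell `(b + 1) * n`. Writing to column
`j` leaves it intact. -/
theorem index_ne {n a b i j : ℕ} (ha : a ≤ b) (hb : b < j) (hj : j < n) :
    b * n + a ≠ j * n + i := by
  have : (b + 1) * n ≤ j * n := Nat.mul_le_mul_right n hb
  rw [Nat.succ_mul] at this
  omega

namespace RealRAM

/-! ### Offsets and the penalty -/

/-- The data for the dynamic programs: sorted points `x` with colours `c`, offsets of the columns of
a square table in natural number array `1`, and the penalty `M` for edges between points of the same
colour. -/
structure Prepared (n : ℕ) (x : ℕ → ℝ) (c : ℕ → ℕ) (M : ℝ) (σ : State) : Prop where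
  out_count : σ.nreg 2 = 0
  one : σ.nreg 3 = 1
  count : σ.nreg 4 = n
  zero : σ.nreg 8 = 0
  points : σ.rarr 5 = x
  colors : σ.narr 0 = c
  offsets : ∀ i < n, σ.narr 1 i = i * n
  penalty : σ.rreg 2 = M

theorem Prepared.congr {n : ℕ} {x : ℕ → ℝ} {c : ℕ → ℕ} {M : ℝ} {σ τ : State}
    (h : Prepared n x c M σ)
    (h2 : τ.nreg 2 = σ.nreg 2 := by simp [exec, Instr.apply])
    (h3 : τ.nreg 3 = σ.nreg 3 := by simp [exec, Instr.apply])
    (h4 : τ.nreg 4 = σ.nreg 4 := by simp [exec, Instr.apply])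
    (h8 : τ.nreg 8 = σ.nreg 8 := by simp [exec, Instr.apply])
    (k5 : τ.rarr 5 = σ.rarr 5 := by simp [exec, Instr.apply])
    (l0 : τ.narr 0 = σ.narr 0 := by simp [exec, Instr.apply])
    (l1 : τ.narr 1 = σ.narr 1 := by simp [exec, Instr.apply])
    (r2 : τ.rreg 2 = σ.rreg 2 := by simp [exec, Instr.apply]) : Prepared n x c M τ :=
  ⟨h2 ▸ h.out_count, h3 ▸ h.one, h4 ▸ h.count, h8 ▸ h.zero, k5 ▸ h.points, l0 ▸ h.colors,
    l1 ▸ h.offsets, r2 ▸ h.penalty⟩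

/-- Compute the offsets and the penalty. -/
def prepareProgram : Program :=
  .seq (block [.rconst 2 1, .nsub 5 4 3, .rload 3 5 5, .nconst 6 0, .rload 1 5 6, .rsub 3 3 1,
      .nconst 10 0, .nconst 5 0])
    (.loop (.nlt 5 4) (block [.nstore 1 5 10, .nadd 10 10 4, .radd 2 2 3, .nadd 5 5 3]))

/-- The machine cannot multiply: the offsets `i * n` and the penalty are accumulated by repeated
addition. -/
theorem prepareProgram_ends {r n : ℕ} {z : ℕ → ℝ} {σ : State} (hσ : HoldsPoints r n z σ) :
    Ends prepareProgram σ (8 + (n * (4 + 1) + 1)) fun τ =>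
      Prepared n (σ.rarr 5) (σ.narr 0) (1 + n * (σ.rarr 5 (n - 1) - σ.rarr 5 0)) τ ∧
        τ.narr 2 0 = 0 ∧ τ.rarr 6 0 = 0 ∧ τ.rarr 7 0 = 0 := by
  refine .seq (.block (Ends.loop (fun k τ => ∃ i, i + k = n ∧ τ.nreg 5 = i ∧ τ.nreg 10 = i * n ∧
    τ.rreg 2 = 1 + i * (σ.rarr 5 (n - 1) - σ.rarr 5 0) ∧
    τ.rreg 3 = σ.rarr 5 (n - 1) - σ.rarr 5 0 ∧ (∀ a < i, τ.narr 1 a = a * n) ∧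
    HoldsPoints r n z τ ∧ τ.rarr 5 = σ.rarr 5 ∧ τ.narr 0 = σ.narr 0) ?_ n _
    ⟨0, by omega, ?_, ?_, ?_, ?_, by simp, hσ.congr, ?_, ?_⟩))
  · rintro k τ ⟨i, hi, h5, h10, r2, r3, h1, h, hx, hc⟩
    rcases k with _ | k
    · obtain rfl : i = n := by omega
      refine .inl ⟨by simp [Test.Holds, h5, h.count], ⟨h.out_count, h.one, h.count, h.zero, hx, hc,
        h1, r2⟩, h.pred, h.stair, h.table⟩
    · refine .inr ⟨by simp only [Test.Holds, h5, h.count]; omega, k, rfl, .block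
        ⟨i + 1, by omega, ?_, ?_, ?_, ?_, ?_, h.congr, ?_, ?_⟩⟩
      · simp [exec, Instr.apply, h5, h.one]
      · simp [exec, Instr.apply, h10, h.count, Nat.succ_mul]
      · simp [exec, Instr.apply, r2, r3]; ring
      · simp [exec, Instr.apply, r3]
      · intro a ha
        simp [exec, Instr.apply, Function.update_apply, h5, h10]
        split_ifs with heq
        · rw [heq]
        · exact h1 a (by omega)
      · simp [exec, Instr.apply, hx]
      · simp [exec, Instr.apply, hc]
  all_goals simp [exec, Instr.apply, hσ.one, hσ.count]

/-! ### Filling the tables -/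

/-- Compute the table of `stairCost` column by column, and the table of optimal chains. -/
def fillProgram : Program :=
  .seq (block [.nconst 6 1, .nmove 10 4, .nconst 11 0])
    (.loop (.nlt 6 4)
      (.seq (block [.rload 4 5 6, .nload 12 0 6, .rconst 5 0, .nadd 14 10 6, .rstore 6 14 5,
          .rmove 6 2, .nmove 5 6])
        (.seq
          -- Rows run downwards from `j - 1`. Real register `5` carries the cell `(i + 1, j)` of the
          -- preceding row, and the cell `(i, j - 1)` is read from the preceding column.
          (.loop (.nlt 8 5)
            (.seq (block [.nsub 7 5 3, .nload 13 0 7, .nadd 14 11 7, .rload 7 6 14])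
              (.seq (.ite (.rlt 7 5) (block [.rmove 5 7]) .skip)
                (.seq (.ite (.neq 13 12) (block [.rmove 8 2]) (block [.rload 8 5 7, .rsub 8 4 8]))
                  (.seq (block [.radd 5 8 5, .nadd 14 10 7, .rstore 6 14 5, .rload 9 7 7,
                      .radd 9 9 5])
                    (.seq (.ite (.rlt 9 6) (block [.rmove 6 9, .nstore 2 6 7]) .skip)
                      (block [.nmove 5 7])))))))
          (block [.rstore 7 6 6, .nmove 11 10, .nadd 10 10 4, .nadd 6 6 3]))))

/-- The columns before column `j` of the tables are filled. -/
structure Filled (n : ℕ) (x : ℕ → ℝ) (c : ℕ → ℕ) (M : ℝ) (j : ℕ) (σ : State) : Prop where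
  prepared : Prepared n x c M σ
  stair : ∀ b < j, ∀ a ≤ b, σ.rarr 6 (b * n + a) = stairCost x c M a b
  table : IsChainTable (stairCost x c M) M j (σ.rarr 7) (σ.narr 2)

/-- The registers are set for column `j`. -/
structure AtColumn (n : ℕ) (x : ℕ → ℝ) (c : ℕ → ℕ) (M : ℝ) (j : ℕ) (σ : State) : Prop where
  filled : Filled n x c M j σ
  index : σ.nreg 6 = j
  offset : σ.nreg 10 = j * n
  pred_offset : σ.nreg 11 = (j - 1) * n

/-- Column `j` is filled from row `a` on, and the chains whose last staircase starts at `m` or later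
have been taken into account. -/
structure Scan (n : ℕ) (x : ℕ → ℝ) (c : ℕ → ℕ) (M : ℝ) (j a m : ℕ) (σ : State) : Prop where
  column : AtColumn n x c M j σ
  point : σ.rreg 4 = x j
  color : σ.nreg 12 = c j
  row : ∀ i, a ≤ i → i ≤ j → σ.rarr 6 (j * n + i) = stairCost x c M i j
  best_le : ∀ i, m ≤ i → i < j → σ.rreg 6 ≤ σ.rarr 7 i + stairCost x c M i j
  best_eq : σ.rreg 6 = M ∨ (σ.narr 2 j < j ∧
    σ.rreg 6 = σ.rarr 7 (σ.narr 2 j) + stairCost x c M (σ.narr 2 j) j)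

section Fill

variable {n : ℕ} {x : ℕ → ℝ} {c : ℕ → ℕ} {M : ℝ} {j a m : ℕ} {σ τ : State}

theorem Filled.congr (h : Filled n x c M j σ) (hp : Prepared n x c M τ)
    (k6 : τ.rarr 6 = σ.rarr 6 := by simp [exec, Instr.apply])
    (k7 : τ.rarr 7 = σ.rarr 7 := by simp [exec, Instr.apply])
    (l2 : τ.narr 2 = σ.narr 2 := by simp [exec, Instr.apply]) : Filled n x c M j τ :=
  ⟨hp, k6 ▸ h.stair, k7 ▸ l2 ▸ h.table⟩

theorem AtColumn.congr (h : AtColumn n x c M j σ) (hf : Filled n x c M j τ)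
    (h6 : τ.nreg 6 = σ.nreg 6 := by simp [exec, Instr.apply])
    (h10 : τ.nreg 10 = σ.nreg 10 := by simp [exec, Instr.apply])
    (h11 : τ.nreg 11 = σ.nreg 11 := by simp [exec, Instr.apply]) : AtColumn n x c M j τ :=
  ⟨hf, h6 ▸ h.index, h10 ▸ h.offset, h11 ▸ h.pred_offset⟩

theorem Scan.congr (h : Scan n x c M j a m σ) (hc : AtColumn n x c M j τ)
    (r4 : τ.rreg 4 = σ.rreg 4 := by simp [exec, Instr.apply])
    (h12 : τ.nreg 12 = σ.nreg 12 := by simp [exec, Instr.apply])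
    (r6 : τ.rreg 6 = σ.rreg 6 := by simp [exec, Instr.apply])
    (k6 : τ.rarr 6 = σ.rarr 6 := by simp [exec, Instr.apply])
    (k7 : τ.rarr 7 = σ.rarr 7 := by simp [exec, Instr.apply])
    (l2 : τ.narr 2 = σ.narr 2 := by simp [exec, Instr.apply]) : Scan n x c M j a m τ := by
  refine ⟨hc, r4 ▸ h.point, h12 ▸ h.color, k6 ▸ h.row, ?_, ?_⟩
  · rw [r6, k7]; exact h.best_le
  · rw [r6, k7, l2]; exact h.best_eq

/-- The value of the current cell of column `j` is stored. -/
theorem Scan.store {i : ℕ} (h : Scan n x c M j (i + 1) m σ) (hj : j < n)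
    (h7 : σ.nreg 7 = i) (r5 : σ.rreg 8 + σ.rreg 5 = stairCost x c M i j) :
    Scan n x c M j i m
      (exec [.radd 5 8 5, .nadd 14 10 7, .rstore 6 14 5, .rload 9 7 7, .radd 9 9 5] σ) := by
  have hcell : (exec [.radd 5 8 5, .nadd 14 10 7, .rstore 6 14 5, .rload 9 7 7, .radd 9 9 5]
      σ).rarr 6 = Function.update (σ.rarr 6) (j * n + i) (stairCost x c M i j) := by
    simp [exec, Instr.apply, h7, h.column.offset, r5]
  refine ⟨h.column.congr ⟨h.column.filled.prepared.congr, ?_, ?_⟩, ?_, ?_, ?_, ?_, ?_⟩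
  · intro b hb a hab
    rw [hcell, Function.update_of_ne (index_ne hab hb hj)]
    exact h.column.filled.stair b hb a hab
  · simpa [exec, Instr.apply] using h.column.filled.table
  · simp [exec, Instr.apply, h.point]
  · simp [exec, Instr.apply, h.color]
  · intro i' hi' hj'
    rw [hcell, Function.update_apply]
    split_ifs with heq
    · rw [show i' = i by omega]
    · exact h.row i' (by omega) hj'
  · simpa [exec, Instr.apply] using h.best_le
  · simpa [exec, Instr.apply] using h.best_eq

/-- A better chain has been found. -/
theorem Scan.improve {i : ℕ} (h : Scan n x c M j a (i + 1) σ) (hij : i < j)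
    (h7 : σ.nreg 7 = i) (r9 : σ.rreg 9 = σ.rarr 7 i + stairCost x c M i j)
    (hlt : σ.rreg 9 < σ.rreg 6) :
    Scan n x c M j a i (exec [.nmove 5 7] (exec [.rmove 6 9, .nstore 2 6 7] σ)) := by
  have hpred : (exec [.nmove 5 7] (exec [.rmove 6 9, .nstore 2 6 7] σ)).narr 2 =
      Function.update (σ.narr 2) j i := by
    simp [exec, Instr.apply, h7, h.column.index]
  have hbest : (exec [.nmove 5 7] (exec [.rmove 6 9, .nstore 2 6 7] σ)).rreg 6 = σ.rreg 9 := by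
    simp [exec, Instr.apply]
  have htab : (exec [.nmove 5 7] (exec [.rmove 6 9, .nstore 2 6 7] σ)).rarr 7 = σ.rarr 7 := by
    simp [exec, Instr.apply]
  refine ⟨h.column.congr ⟨h.column.filled.prepared.congr, ?_, ?_⟩, ?_, ?_, ?_, ?_, ?_⟩
  · simpa [exec, Instr.apply] using h.column.filled.stair
  · rw [htab, hpred]
    -- The table of the finished columns does not involve the tentative predecessor stored for `j`.
    exact h.column.filled.table.congr (by omega) (fun _ _ => rfl)
      fun b hb => Function.update_of_ne hb.ne _ _
  · simp [exec, Instr.apply, h.point]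
  · simp [exec, Instr.apply, h.color]
  · simpa [exec, Instr.apply] using h.row
  · intro i' hi' hj'
    rw [hbest, htab]
    rcases hi'.eq_or_lt with rfl | hlt'
    · exact r9.le
    · exact hlt.le.trans (h.best_le i' hlt' hj')
  · right
    rw [hbest, htab, hpred, Function.update_self]
    exact ⟨hij, r9⟩

theorem Scan.keep {i : ℕ} (h : Scan n x c M j a (i + 1) σ)
    (r9 : σ.rreg 9 = σ.rarr 7 i + stairCost x c M i j) (hle : σ.rreg 6 ≤ σ.rreg 9) :
    Scan n x c M j a i (exec [.nmove 5 7] σ) := by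
  have h' : Scan n x c M j a i σ := by
    refine ⟨h.column, h.point, h.color, h.row, fun i' hi' hj' => ?_, h.best_eq⟩
    rcases hi'.eq_or_lt with rfl | hlt'
    · exact hle.trans r9.le
    · exact h.best_le i' hlt' hj'
  exact h'.congr (h'.column.congr (h'.column.filled.congr h'.column.filled.prepared.congr))

/-- One cell of column `j`. -/
theorem scan_step {i : ℕ} (h : Scan n x c M j (i + 1) (i + 1) σ) (hij : i < j) (hj : j < n)
    (h5 : σ.nreg 5 = i + 1) (r5 : σ.rreg 5 = stairCost x c M (i + 1) j) :
    Ends (.seq (block [.nsub 7 5 3, .nload 13 0 7, .nadd 14 11 7, .rload 7 6 14])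
      (.seq (.ite (.rlt 7 5) (block [.rmove 5 7]) .skip)
        (.seq (.ite (.neq 13 12) (block [.rmove 8 2]) (block [.rload 8 5 7, .rsub 8 4 8]))
          (.seq (block [.radd 5 8 5, .nadd 14 10 7, .rstore 6 14 5, .rload 9 7 7, .radd 9 9 5])
            (.seq (.ite (.rlt 9 6) (block [.rmove 6 9, .nstore 2 6 7]) .skip)
              (block [.nmove 5 7])))))) σ 18 fun τ =>
      Scan n x c M j i i τ ∧ τ.nreg 5 = i ∧ τ.rreg 5 = stairCost x c M i j := by
  have hp := h.column.filled.prepared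
  refine .le (.seq (u := 14) (.block (.seq (t := 2) (u := 12) (Ends.mono (t := 2)
    (Q := fun τ => Scan n x c M j (i + 1) (i + 1) τ ∧ τ.nreg 7 = i ∧ τ.nreg 13 = c i ∧
      τ.rreg 5 = min (stairCost x c M (i + 1) j) (stairCost x c M i (j - 1))) ?_ le_rfl ?_))))
    (by simp)
  · have h0 : Scan n x c M j (i + 1) (i + 1)
        (exec [.nsub 7 5 3, .nload 13 0 7, .nadd 14 11 7, .rload 7 6 14] σ) :=
      h.congr (h.column.congr (h.column.filled.congr hp.congr))
    have h7 : (exec [.nsub 7 5 3, .nload 13 0 7, .nadd 14 11 7, .rload 7 6 14] σ).nreg 7 = i := by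
      simp [exec, Instr.apply, h5, hp.one]
    have h13 : (exec [.nsub 7 5 3, .nload 13 0 7, .nadd 14 11 7, .rload 7 6 14] σ).nreg 13
        = c i := by
      simp [exec, Instr.apply, h5, hp.one, hp.colors]
    have k5 : (exec [.nsub 7 5 3, .nload 13 0 7, .nadd 14 11 7, .rload 7 6 14] σ).rreg 5
        = stairCost x c M (i + 1) j := by
      simp [exec, Instr.apply, r5]
    have k7 : (exec [.nsub 7 5 3, .nload 13 0 7, .nadd 14 11 7, .rload 7 6 14] σ).rreg 7
        = stairCost x c M i (j - 1) := by
      simp [exec, Instr.apply, h5, hp.one, h.column.pred_offset,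
        h.column.filled.stair (j - 1) (by omega) i (by omega)]
    generalize exec [.nsub 7 5 3, .nload 13 0 7, .nadd 14 11 7, .rload 7 6 14] σ = τ at *
    refine .ite (fun hb => .block ⟨h0.congr (h0.column.congr (h0.column.filled.congr
      h0.column.filled.prepared.congr)), ?_, ?_, ?_⟩) (fun hb => (Ends.skip ⟨h0, h7, h13, ?_⟩).le
      (by simp))
    · simp [exec, Instr.apply, h7]
    · simp [exec, Instr.apply, h13]
    · simp only [Test.Holds, k7, k5] at hb
      simp [exec, Instr.apply, k7, hb.le]
    · simp only [Test.Holds, k7, k5, not_lt] at hb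
      rw [k5, min_eq_left hb]
  · rintro τ ⟨h, h7, h13, r5⟩
    have hp := h.column.filled.prepared
    refine .seq (t := 3) (u := 9) (Ends.mono (t := 3) (Q := fun τ =>
      Scan n x c M j (i + 1) (i + 1) τ ∧ τ.nreg 7 = i ∧
      τ.rreg 8 + τ.rreg 5 = stairCost x c M i j) ?_ le_rfl ?_)
    · refine .ite (t := 2) (fun hb => (Ends.block (l := [.rmove 8 2]) ⟨h.congr (h.column.congr
        (h.column.filled.congr hp.congr)), ?_, ?_⟩).le (by simp)) (fun hb => .block ⟨h.congr
        (h.column.congr (h.column.filled.congr hp.congr)), ?_, ?_⟩)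
      · simp [exec, Instr.apply, h7]
      · simp only [Test.Holds, h13, h.color] at hb
        rw [stairCost_of_lt hij, edgeCost, if_neg hb]
        simp [exec, Instr.apply, r5, h7, h.point, hp.points]
      · simp [exec, Instr.apply, h7]
      · simp only [Test.Holds, h13, h.color] at hb
        rw [stairCost_of_lt hij, edgeCost, if_pos hb]
        simp [exec, Instr.apply, r5, hp.penalty]
    · rintro τ ⟨h, h7, r5⟩
      refine .le (.seq (u := 4) (.block ?_)) (by simp)
      have h0 := h.store hj h7 r5
      have k7 : (exec [.radd 5 8 5, .nadd 14 10 7, .rstore 6 14 5, .rload 9 7 7, .radd 9 9 5]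
          τ).nreg 7 = i := by
        simp [exec, Instr.apply, h7]
      have k5 : (exec [.radd 5 8 5, .nadd 14 10 7, .rstore 6 14 5, .rload 9 7 7, .radd 9 9 5]
          τ).rreg 5 = stairCost x c M i j := by
        simp [exec, Instr.apply, r5]
      have k9 : (exec [.radd 5 8 5, .nadd 14 10 7, .rstore 6 14 5, .rload 9 7 7, .radd 9 9 5]
          τ).rreg 9 = (exec [.radd 5 8 5, .nadd 14 10 7, .rstore 6 14 5, .rload 9 7 7,
            .radd 9 9 5] τ).rarr 7 i + stairCost x c M i j := by
        simp [exec, Instr.apply, r5, h7]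
      generalize exec [.radd 5 8 5, .nadd 14 10 7, .rstore 6 14 5, .rload 9 7 7, .radd 9 9 5] τ
        = υ at *
      refine .seq (t := 3) (u := 1) (.ite (t := 2) (fun hb => .block (.block
        ⟨h0.improve hij k7 k9 hb, ?_, ?_⟩)) (fun hb => .le (.skip (.block
        ⟨h0.keep k9 (not_lt.1 hb), ?_, ?_⟩)) (by simp)))
      all_goals simp [exec, Instr.apply, k7, k5]

/-- Column `0` is already correct: the diagonal cell, the chain value and the predecessor are all
the initial `0`. Each further column takes at most `n` rows of constant cost. -/
theorem fillProgram_ends (hn : 0 < n) (hσ : Prepared n x c M σ) (hp : σ.narr 2 0 = 0)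
    (hs : σ.rarr 6 0 = 0) (ht : σ.rarr 7 0 = 0) :
    Ends fillProgram σ (3 + (n * (n * 19 + 12 + 1) + 1)) (Filled n x c M n) := by
  refine .seq (.block ((Ends.loop (t := n * 19 + 12) (fun k τ => ∃ j, j + k = n ∧ 0 < j ∧
    AtColumn n x c M j τ) ?_ (n - 1) _ ⟨1, by omega, by omega,
    ⟨⟨hσ.congr, ?_, ⟨?_, ?_, ?_, ?_⟩⟩, ?_, ?_, ?_⟩⟩).le ?_))
  · rintro k τ ⟨j, hj, hj0, h⟩
    rcases k with _ | k
    · obtain rfl : j = n := by omega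
      exact .inl ⟨by simp [Test.Holds, h.index, h.filled.prepared.count], h.filled⟩
    have hp := h.filled.prepared
    refine .inr ⟨by simp only [Test.Holds, h.index, hp.count]; omega, k, rfl,
      .le (.seq (u := n * 19 + 5) (.block (.seq (t := n * 19 + 1) (u := 4) (Ends.mono
      (t := j * (18 + 1) + 1) (Ends.loop (t := 18) (fun k' τ => k' ≤ j ∧ Scan n x c M j k' k' τ ∧
      τ.nreg 5 = k' ∧ τ.rreg 5 = stairCost x c M k' j) (Q := Scan n x c M j 0 0) ?_ j _
      ⟨le_rfl, ⟨h.congr ⟨hp.congr, ?_, ?_⟩, ?_, ?_, ?_, ?_, ?_⟩, ?_, ?_⟩) ?_ ?_))))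
      (by simp; omega)⟩
    · rintro k' τ ⟨hk', h, h5, r5⟩
      rcases k' with _ | k'
      · refine .inl ⟨by simp [Test.Holds, h5], h⟩
      · refine .inr ⟨by simp [Test.Holds, h5, h.column.filled.prepared.zero], k', rfl, ?_⟩
        exact (scan_step h hk' (by omega) h5 r5).mono le_rfl fun τ h => ⟨by omega, h⟩
    · intro b hb a hab
      simp only [exec, List.foldl, Instr.apply, Function.update_apply]
      simp [h.index, h.offset, index_ne hab hb (show j < n by omega), h.filled.stair b hb a hab]
    · simpa [exec, Instr.apply] using h.filled.table
    · simp [exec, Instr.apply, h.index, hp.points]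
    · simp [exec, Instr.apply, h.index, hp.colors]
    · intro i hi hi'
      obtain rfl : i = j := by omega
      simp [exec, Instr.apply, h.index, h.offset, stairCost_self]
    · intro i hi hi'
      omega
    · simp [exec, Instr.apply, hp.penalty]
    · simp [exec, Instr.apply, h.index]
    · simp [exec, Instr.apply, stairCost_self]
    · have : j * 19 ≤ n * 19 := by omega
      omega
    · intro υ hs
      refine .block ⟨j + 1, by omega, by omega, ⟨⟨hs.column.filled.prepared.congr, ?_, ?_⟩, ?_, ?_,
        ?_⟩⟩
      · intro b hb a hab
        have : υ.rarr 6 (b * n + a) = stairCost x c M a b := by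
          rcases Nat.lt_succ_iff_lt_or_eq.1 hb with hlt | rfl
          · exact hs.column.filled.stair b hlt a hab
          · exact hs.row a (Nat.zero_le _) hab
        simpa [exec, Instr.apply] using this
      · have := hs.column.filled.table.extend hj0 (fun m hm => hs.best_le m (Nat.zero_le _) hm)
          hs.best_eq
        simpa [exec, Instr.apply, hs.column.index] using this
      · simp [exec, Instr.apply, hs.column.index, hs.column.filled.prepared.one]
      · simp [exec, Instr.apply, hs.column.offset, hs.column.filled.prepared.count, Nat.succ_mul]
      · simp [exec, Instr.apply, hs.column.offset]
  · intro b hb a hab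
    obtain rfl : b = 0 := by omega
    obtain rfl : a = 0 := by omega
    simp [exec, Instr.apply, hs, stairCost_self]
  · simp [exec, Instr.apply, ht]
  · simp [exec, Instr.apply, hp]
  · intro j hj m hm; omega
  · intro j hj hj0; omega
  · simp [exec, Instr.apply]
  · simp [exec, Instr.apply, hσ.count]
  · simp [exec, Instr.apply]
  · have : (n - 1) * (n * 19 + 12 + 1) ≤ n * (n * 19 + 12 + 1) :=
      Nat.mul_le_mul_right _ (Nat.sub_le _ _)
    omega

end Fill

end RealRAM

namespace RealRAM

/-! ### Writing the output -/

/-- Enumerate the edges of an optimal chain of staircases. -/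
def outputProgram : Program :=
  .seq (block [.nsub 6 4 3, .nload 15 2 6, .nmove 7 15])
    (.loop (.nlt 8 6)
      (.seq (block [.rload 0 5 7, .rload 1 5 6, .nload 13 0 7])
        (.seq (.ite (.neq 13 8) (block [.rstore 2 2 0, .rstore 3 2 1])
            (block [.rstore 2 2 1, .rstore 3 2 0]))
          (.seq (block [.nadd 2 2 3, .nload 10 1 6, .nadd 14 10 7, .nadd 14 14 3, .rload 4 6 14,
              .nsub 5 6 3, .nload 11 1 5, .nadd 14 11 7, .rload 5 6 14])
            -- The end to be dropped was not recorded; it is found again by comparing the two cells.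
            -- Ties may be broken either way.
            (.seq (.ite (.rlt 4 5) (block [.nadd 7 7 3]) (block [.nmove 6 5]))
              (.ite (.neq 6 7) (block [.nmove 6 15, .nload 15 2 6, .nmove 7 15]) .skip))))))

/-- The tables are filled, and the edges `E` have been written. -/
structure Writing (n : ℕ) (x : ℕ → ℝ) (c : ℕ → ℕ) (M : ℝ) (F : ℕ → ℝ) (p : ℕ → ℕ)
    (E : List (ℕ × ℕ)) (σ : State) : Prop where
  one : σ.nreg 3 = 1
  zero : σ.nreg 8 = 0
  points : σ.rarr 5 = x
  colors : σ.narr 0 = c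
  offsets : ∀ i < n, σ.narr 1 i = i * n
  stair : ∀ b < n, ∀ a ≤ b, σ.rarr 6 (b * n + a) = stairCost x c M a b
  pred : σ.narr 2 = p
  output : σ.outputEdges = E.map (orientEdge x c)

section Output

variable {n : ℕ} {x : ℕ → ℝ} {c : ℕ → ℕ} {M : ℝ} {F : ℕ → ℝ} {p : ℕ → ℕ} {E : List (ℕ × ℕ)}
  {i j s : ℕ} {σ τ : State}

theorem Writing.congr (h : Writing n x c M F p E σ)
    (h2 : τ.nreg 2 = σ.nreg 2 := by simp [exec, Instr.apply])
    (h3 : τ.nreg 3 = σ.nreg 3 := by simp [exec, Instr.apply])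
    (h8 : τ.nreg 8 = σ.nreg 8 := by simp [exec, Instr.apply])
    (k2 : τ.rarr 2 = σ.rarr 2 := by simp [exec, Instr.apply])
    (k3 : τ.rarr 3 = σ.rarr 3 := by simp [exec, Instr.apply])
    (k5 : τ.rarr 5 = σ.rarr 5 := by simp [exec, Instr.apply])
    (k6 : τ.rarr 6 = σ.rarr 6 := by simp [exec, Instr.apply])
    (l0 : τ.narr 0 = σ.narr 0 := by simp [exec, Instr.apply])
    (l1 : τ.narr 1 = σ.narr 1 := by simp [exec, Instr.apply])
    (l2 : τ.narr 2 = σ.narr 2 := by simp [exec, Instr.apply]) : Writing n x c M F p E τ := by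
  refine ⟨h3 ▸ h.one, h8 ▸ h.zero, k5 ▸ h.points, l0 ▸ h.colors, l1 ▸ h.offsets, k6 ▸ h.stair,
    l2 ▸ h.pred, ?_⟩
  rw [← h.output, State.outputEdges, State.outputEdges, h2, k2, k3]

/-- Appending one edge to the output. -/
theorem outputEdges_append {e : ℝ × ℝ} (h2 : τ.nreg 2 = σ.nreg 2 + 1)
    (k2 : τ.rarr 2 = Function.update (σ.rarr 2) (σ.nreg 2) e.1)
    (k3 : τ.rarr 3 = Function.update (σ.rarr 3) (σ.nreg 2) e.2) :
    τ.outputEdges = σ.outputEdges ++ [e] := by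
  rw [State.outputEdges, State.outputEdges, h2, List.range_succ, List.map_append, k2, k3]
  congr 1
  · refine List.map_congr_left fun i hi => ?_
    have := (List.mem_range.1 hi).ne
    rw [Function.update_of_ne this, Function.update_of_ne this]
  · simp

theorem Writing.append (h : Writing n x c M F p E σ) {l : List Instr} {a b : ℕ}
    (hl : l = [.rstore 2 2 a, .rstore 3 2 b])
    (hab : (σ.rreg a, σ.rreg b) = orientEdge x c (i, j)) (hij : i < j) (hj : j < n)
    (h7 : σ.nreg 7 = i) (h6 : σ.nreg 6 = j) (h15 : σ.nreg 15 = s)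
    {υ : State} (hυ : υ = exec [.nadd 2 2 3, .nload 10 1 6, .nadd 14 10 7, .nadd 14 14 3,
      .rload 4 6 14, .nsub 5 6 3, .nload 11 1 5, .nadd 14 11 7, .rload 5 6 14] (exec l σ)) :
    Writing n x c M F p (E ++ [(i, j)]) υ ∧ υ.nreg 7 = i ∧ υ.nreg 6 = j ∧ υ.nreg 15 = s ∧
      υ.nreg 5 = j - 1 ∧ υ.rreg 4 = stairCost x c M (i + 1) j ∧
      υ.rreg 5 = stairCost x c M i (j - 1) := by
  subst hl hυ
  refine ⟨⟨?_, ?_, ?_, ?_, ?_, ?_, ?_, ?_⟩, ?_, ?_, ?_, ?_, ?_, ?_⟩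
  case refine_8 =>
    rw [List.map_append, ← h.output]
    refine outputEdges_append ?_ ?_ ?_
    · simp [exec, Instr.apply, h.one]
    · rw [← hab]; simp [exec, Instr.apply]
    · rw [← hab]; simp [exec, Instr.apply]
  · simp [exec, Instr.apply, h.one]
  · simp [exec, Instr.apply, h.zero]
  · simp [exec, Instr.apply, h.points]
  · simp [exec, Instr.apply, h.colors]
  · simpa [exec, Instr.apply] using h.offsets
  · simpa [exec, Instr.apply] using h.stair
  · simp [exec, Instr.apply, h.pred]
  · simp [exec, Instr.apply, h7]
  · simp [exec, Instr.apply, h6]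
  · simp [exec, Instr.apply, h15]
  · simp [exec, Instr.apply, h6, h.one]
  · simp [exec, Instr.apply, h6, h7, h.one, h.offsets j hj, add_assoc, h.stair j hj (i + 1) hij]
  · simp [exec, Instr.apply, h6, h7, h.one, h.offsets (j - 1) (by omega),
      h.stair (j - 1) (by omega) i (by omega)]

/-- The number `(j - i) + s` of edges still to be listed starts at `n - 1` and drops by one per
round. Passing to the next staircase, from `(i, i, s)` to `(p s, s, p s)`, does not change it. -/
theorem outputProgram_ends (hn : 1 < n) (hx : MonotoneOn x (Set.Iio n)) (hM : 0 ≤ M)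
    (hσ : Filled n x c M n σ) (hlt : σ.rarr 7 (n - 1) < M) :
    Ends outputProgram σ (3 + (n * (21 + 1) + 1)) fun τ => ∃ E i s,
      EnumState x c M n (σ.rarr 7) E i 0 s ∧ τ.outputEdges = E.map (orientEdge x c) := by
  have hF := hσ.table
  have hp := hσ.prepared
  obtain ⟨hstart, hstart'⟩ := EnumState.start hF hlt hn
  generalize σ.rarr 7 = F at *
  refine .seq (.block ((Ends.loop (t := 21) (fun k τ => ∃ E i j s, k = (j - i) + s ∧
    (0 < j → i < j) ∧ EnumState x c M n F E i j s ∧ Writing n x c M F (σ.narr 2) E τ ∧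
    τ.nreg 7 = i ∧ τ.nreg 6 = j ∧ τ.nreg 15 = s) ?_ (n - 1) _ ⟨[], σ.narr 2 (n - 1), n - 1,
      σ.narr 2 (n - 1), by omega, fun _ => hstart', hstart, ⟨?_, ?_, ?_, ?_, ?_, ?_, ?_, ?_⟩,
      ?_, ?_, ?_⟩).le (by omega)))
  · rintro k τ ⟨E, i, j, s, hk, hij, h, hw, h7, h6, h15⟩
    rcases Nat.eq_zero_or_pos j with rfl | hj0
    · exact .inl ⟨by simp [Test.Holds, h6], E, i, s, h, hw.output⟩
    have hij := hij hj0
    obtain ⟨k, rfl⟩ : ∃ k', k = k' + 1 := ⟨k - 1, by omega⟩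
    refine .inr ⟨by simpa [Test.Holds, h6, hw.zero], k, rfl, .le (.seq (u := 18) (.block ?_))
      (by simp)⟩
    have hw0 : Writing n x c M F (σ.narr 2) E
      (exec [.rload 0 5 7, .rload 1 5 6, .nload 13 0 7] τ) := hw.congr
    have k7 : (exec [.rload 0 5 7, .rload 1 5 6, .nload 13 0 7] τ).nreg 7 = i := by
      simp [exec, Instr.apply, h7]
    have k6 : (exec [.rload 0 5 7, .rload 1 5 6, .nload 13 0 7] τ).nreg 6 = j := by
      simp [exec, Instr.apply, h6]
    have k15 : (exec [.rload 0 5 7, .rload 1 5 6, .nload 13 0 7] τ).nreg 15 = s := by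
      simp [exec, Instr.apply, h15]
    have k13 : (exec [.rload 0 5 7, .rload 1 5 6, .nload 13 0 7] τ).nreg 13 = c i := by
      simp [exec, Instr.apply, hw.colors, h7]
    have r0 : (exec [.rload 0 5 7, .rload 1 5 6, .nload 13 0 7] τ).rreg 0 = x i := by
      simp [exec, Instr.apply, hw.points, h7]
    have r1 : (exec [.rload 0 5 7, .rload 1 5 6, .nload 13 0 7] τ).rreg 1 = x j := by
      simp [exec, Instr.apply, hw.points, h6]
    generalize exec [.rload 0 5 7, .rload 1 5 6, .nload 13 0 7] τ = τ at *
    have tail : ∀ υ : State, Writing n x c M F (σ.narr 2) (E ++ [(i, j)]) υ ∧ υ.nreg 7 = i ∧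
        υ.nreg 6 = j ∧ υ.nreg 15 = s ∧ υ.nreg 5 = j - 1 ∧
        υ.rreg 4 = stairCost x c M (i + 1) j ∧ υ.rreg 5 = stairCost x c M i (j - 1) →
        Ends (.seq (.ite (.rlt 4 5) (block [.nadd 7 7 3]) (block [.nmove 6 5]))
          (.ite (.neq 6 7) (block [.nmove 6 15, .nload 15 2 6, .nmove 7 15]) .skip)) υ 6
          fun τ => ∃ E i j s, k = (j - i) + s ∧ (0 < j → i < j) ∧ EnumState x c M n F E i j s ∧
            Writing n x c M F (σ.narr 2) E τ ∧ τ.nreg 7 = i ∧ τ.nreg 6 = j ∧ τ.nreg 15 = s := by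
      rintro υ ⟨hw, h7, h6, h15, h5, r4, r5⟩
      refine .seq (t := 2) (u := 4) (Ends.mono (t := 2) (Q := fun τ => ∃ i' j',
        k = (j' - i') + s ∧ EnumState x c M n F (E ++ [(i, j)]) i' j' s ∧
          Writing n x c M F (σ.narr 2) (E ++ [(i, j)]) τ ∧ τ.nreg 7 = i' ∧ τ.nreg 6 = j' ∧
          τ.nreg 15 = s) ?_ le_rfl ?_)
      · refine .ite (t := 1) (fun hb => .block ⟨i + 1, j, by omega, h.step_left hij ?_, hw.congr,
          ?_, ?_, ?_⟩) (fun hb => .block ⟨i, j - 1, by omega, h.step_right hij ?_, hw.congr,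
          ?_, ?_, ?_⟩)
        · simp only [Test.Holds, r4, r5] at hb
          exact hb.le
        · simp [exec, Instr.apply, h7, hw.one]
        · simp [exec, Instr.apply, h6]
        · simp [exec, Instr.apply, h15]
        · simp only [Test.Holds, r4, r5, not_lt] at hb
          exact hb
        · simp [exec, Instr.apply, h7]
        · simp [exec, Instr.apply, h5]
        · simp [exec, Instr.apply, h15]
      · rintro υ ⟨i, j, hk, h, hw, h7, h6, h15⟩
        refine .ite (t := 3) (fun hb => ?_) (fun hb => .le (.skip ?_) (by simp))
        · simp only [Test.Holds, h6, h7] at hb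
          subst hb
          obtain ⟨h', hlt'⟩ := h.next hx hM hF hlt
          have := h'.le_right
          refine .block ⟨E ++ _, σ.narr 2 s, s, σ.narr 2 s, by omega, hlt', h', hw.congr,
            ?_, ?_, ?_⟩
          all_goals simp [exec, Instr.apply, h15, hw.pred]
        · simp only [Test.Holds, h6, h7] at hb
          have := h.le_right
          exact ⟨_, i, j, s, hk, fun _ => by omega, h, hw, h7, h6, h15⟩
    refine .seq (t := 3) (u := 15) (.ite (t := 2)
      (fun hb => .block (.le (.seq (u := 6) (.block (tail _ (hw0.append (a := 0) (b := 1) rfl ?_ hij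
        h.lt k7 k6 k15 rfl)))) (by simp)))
      (fun hb => .block (.le (.seq (u := 6) (.block (tail _ (hw0.append (a := 1) (b := 0) rfl ?_ hij
        h.lt k7 k6 k15 rfl)))) (by simp))))
    · simp only [Test.Holds, k13, hw0.zero] at hb
      simp [orientEdge, hb, r0, r1]
    · simp only [Test.Holds, k13, hw0.zero] at hb
      simp [orientEdge, hb, r0, r1]
  · simp [exec, Instr.apply, hp.one]
  · simp [exec, Instr.apply, hp.zero]
  · simp [exec, Instr.apply, hp.points]
  · simp [exec, Instr.apply, hp.colors]
  · simpa [exec, Instr.apply] using hp.offsets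
  · simpa [exec, Instr.apply] using hσ.stair
  · simp [exec, Instr.apply]
  · simp [exec, Instr.apply, State.outputEdges, hp.out_count]
  · simp [exec, Instr.apply, hp.count, hp.one]
  · simp [exec, Instr.apply, hp.count, hp.one]
  · simp [exec, Instr.apply, hp.count, hp.one]

end Output

end RealRAM

namespace RealRAM

/-! ### The whole program -/

theorem injOn_getD {l : List ℝ} (h : l.Nodup) :
    Set.InjOn (fun i => l.getD i 0) (Set.Iio l.length) := by
  intro i hi j hj hij
  simp only [Set.mem_Iio] at hi hj
  simp only [List.getD_eq_getElem _ _ hi, List.getD_eq_getElem _ _ hj] at hij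
  exact (h.getElem_inj_iff).1 hij

/-- An injective self-map of a finite set is onto, so every cell below `n` receives a point. -/
theorem countLess_surjOn {z : ℕ → ℝ} {n : ℕ} (hz : Set.InjOn z (Set.Iio n)) {i : ℕ} (hi : i < n) :
    ∃ a < n, countLess z n (z a) = i := by
  have hmaps : ∀ a ∈ Finset.range n, countLess z n (z a) ∈ Finset.range n := fun a ha =>
    Finset.mem_range.2 (countLess_lt_self (Finset.mem_range.1 ha))
  have hinj : Set.InjOn (fun a => countLess z n (z a)) (Finset.range n) := fun a ha b hb hab =>
    countLess_injOn hz (Finset.mem_range.1 ha) (Finset.mem_range.1 hb) hab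
  obtain ⟨a, ha, hai⟩ := Finset.surjOn_of_injOn_of_card_le _ hmaps hinj le_rfl
    (Finset.mem_coe.2 (Finset.mem_range.2 hi))
  exact ⟨a, Finset.mem_range.1 ha, hai⟩

theorem Sorting.isSortedColoring {reds blues : List ℝ} {σ : State}
    (hz : Set.InjOn (fun i => (reds ++ blues).getD i 0) (Set.Iio (reds.length + blues.length)))
    (h : Sorting reds.length (reds.length + blues.length) (fun i => (reds ++ blues).getD i 0)
      (reds.length + blues.length) σ) :
    IsSortedColoring reds.toFinset blues.toFinset (reds.length + blues.length) (σ.rarr 5)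
      (σ.narr 0) := by
  have hred : ∀ a, a < reds.length → (reds ++ blues).getD a 0 = reds.getD a 0 := fun a ha =>
    List.getD_append _ _ _ _ ha
  have hblue : ∀ a, reds.length ≤ a →
      (reds ++ blues).getD a 0 = blues.getD (a - reds.length) 0 := fun a ha =>
    List.getD_append_right _ _ _ _ ha
  generalize hzz : (fun i => (reds ++ blues).getD i 0) = z at *
  have hred' : ∀ a, a < reds.length → z a ∈ reds := fun a ha => by
    rw [← hzz]
    simp only [hred a ha, List.getD_eq_getElem _ _ ha]
    exact List.getElem_mem ha
  have hblue' : ∀ a, reds.length ≤ a → a < reds.length + blues.length → z a ∈ blues :=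
    fun a ha ha' => by
    have hlt : a - reds.length < blues.length := by omega
    rw [← hzz]
    simp only [hblue a ha, List.getD_eq_getElem _ _ hlt]
    exact List.getElem_mem hlt
  have hall : ∀ y ∈ reds ++ blues, ∃ a < reds.length + blues.length, z a = y := by
    intro y hy
    obtain ⟨a, ha, rfl⟩ := List.mem_iff_getElem.1 hy
    refine ⟨a, by simpa using ha, ?_⟩
    rw [← hzz]
    exact List.getD_eq_getElem _ _ ha
  generalize hn : reds.length + blues.length = n at *
  refine ⟨?_, h.holds.colors, ?_, ?_, ?_⟩
  · intro i hi j hj hij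
    obtain ⟨a, ha, rfl⟩ := countLess_surjOn hz (Set.mem_Iio.1 hi)
    obtain ⟨b, hb, rfl⟩ := countLess_surjOn hz (Set.mem_Iio.1 hj)
    rw [(h.placed a ha).1, (h.placed b hb).1]
    by_contra! hle
    rcases hle.eq_or_lt with heq | hlt
    · rw [heq] at hij
      exact hij.false
    · exact hij.not_gt (countLess_lt hb hlt)
  · intro i hi hc
    obtain ⟨a, ha, rfl⟩ := countLess_surjOn hz hi
    rw [(h.placed a ha).2] at hc
    rw [(h.placed a ha).1, List.mem_toFinset]
    split_ifs at hc with hr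
    exact hred' a hr
  · intro i hi hc
    obtain ⟨a, ha, rfl⟩ := countLess_surjOn hz hi
    rw [(h.placed a ha).2] at hc
    rw [(h.placed a ha).1, List.mem_toFinset]
    split_ifs at hc with hr
    exact hblue' a (not_lt.1 hr) ha
  · intro y hy
    obtain ⟨a, ha, rfl⟩ := hall y (by simpa using hy)
    exact ⟨_, countLess_lt_self ha, (h.placed a ha).1⟩

/-- Compute a minimum-weight non-crossing bichromatic spanning tree. -/
def treeProgram : Program :=
  .seq concatProgram (.seq sortProgram (.seq prepareProgram (.seq fillProgram outputProgram)))

/-- Quadratically many steps lead to an optimal tree once the points are sorted. -/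
theorem treeProgram_ends {reds blues : List ℝ} (hr : reds.Nodup) (hb : blues.Nodup)
    (hd : Disjoint reds.toFinset blues.toFinset) (hr0 : reds ≠ []) (hb0 : blues ≠ []) :
    Ends treeProgram (inputState reds blues) (120 * (reds.length + blues.length) ^ 2) fun σ =>
      σ.outputEdges.Nodup ∧ IsOptimalNonCrossingSpanningTree reds.toFinset blues.toFinset
        σ.outputEdges.toFinset := by
  have hrl := List.length_pos_of_ne_nil hr0
  have hbl := List.length_pos_of_ne_nil hb0
  have hinj := injOn_getD (l := reds ++ blues) (List.nodup_append'.2 ⟨hr, hb,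
    fun a ha hb => Finset.disjoint_left.1 hd (List.mem_toFinset.2 ha) (List.mem_toFinset.2 hb)⟩)
  rw [List.length_append] at hinj
  refine .le (.seq ((concatProgram_ends reds blues).mono le_rfl fun σ hσ => .seq
    ((sortProgram_ends hinj hσ).mono le_rfl fun σ hs => .seq
      (u := 3 + ((reds.length + blues.length) * ((reds.length + blues.length) * 19 + 12 + 1) + 1) +
        (3 + ((reds.length + blues.length) * (21 + 1) + 1)))
    ((prepareProgram_ends hs.holds).mono le_rfl ?_)))) ?_
  · have hcol := hs.isSortedColoring hinj
    rintro σ' ⟨hp, hp2, hp6, hp7⟩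
    generalize σ.rarr 5 = x at *
    generalize σ.narr 0 = c at *
    generalize hn : reds.length + blues.length = n at *
    have hS : ∀ i j, i ≤ j → j < n → x j - x i ≤ x (n - 1) - x 0 := by
      intro i j hij hj
      have h1 : x 0 ≤ x i := hcol.strictMono.monotoneOn (Set.mem_Iio.2 (by omega))
        (Set.mem_Iio.2 (by omega)) (Nat.zero_le _)
      have h2 : x j ≤ x (n - 1) := hcol.strictMono.monotoneOn (Set.mem_Iio.2 (by omega))
        (Set.mem_Iio.2 (by omega)) (by omega)
      linarith
    have hS0 := hS 0 0 le_rfl (by omega)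
    rw [sub_self] at hS0
    generalize hM : 1 + (n : ℝ) * (x (n - 1) - x 0) = M at *
    have hM0 : 0 ≤ M := by rw [← hM]; positivity
    refine .seq ((fillProgram_ends (by omega) hp hp2 hp6 hp7).mono le_rfl fun τ hf => ?_)
    have hlt : τ.rarr 7 (n - 1) < M := by
      have hex : ∃ u < n - 1, c u ≠ c (n - 1) := by
        have hne : ∃ u < n, c u ≠ c (n - 1) := by
          by_contra! hcon
          obtain ⟨a, ha⟩ := List.exists_mem_of_ne_nil _ hr0
          obtain ⟨b, hb⟩ := List.exists_mem_of_ne_nil _ hb0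
          obtain ⟨i, hi, rfl⟩ := hcol.surj a (Finset.mem_union_left _ (List.mem_toFinset.2 ha))
          obtain ⟨j, hj, rfl⟩ := hcol.surj b (Finset.mem_union_right _ (List.mem_toFinset.2 hb))
          have h1 := (hcol.red_iff hd hi).1 (List.mem_toFinset.2 ha)
          have h2 := (hcol.blue_iff hd hj).1 (List.mem_toFinset.2 hb)
          have h3 := hcon i hi
          have h4 := hcon j hj
          omega
        obtain ⟨u, hu, hu'⟩ := hne
        have : u ≠ n - 1 := by rintro rfl; exact hu' rfl
        exact ⟨u, by omega, hu'⟩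
      -- The optimum is at most `n - 1` times the spread of the points; the summand `1` in `M` makes
      -- the inequality strict even so.
      have h1 := hf.table.le_mul hS (by omega) hex
      have h2 : ((n - 1 : ℕ) : ℝ) * (x (n - 1) - x 0) ≤ n * (x (n - 1) - x 0) :=
        mul_le_mul_of_nonneg_right (by exact_mod_cast Nat.sub_le n 1) hS0
      linarith
    refine (outputProgram_ends (by omega) hcol.strictMono.monotoneOn hM0 hf hlt).mono le_rfl ?_
    rintro υ ⟨E, i, s, hE, hout⟩
    rw [hout]
    exact hE.isOptimal hf.table hcol hd hM0 hlt
  -- With `n` points the five phases take at most `24 * n ^ 2 + 55 * n + 23` steps in total, and `n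
  -- ≥ 1`.
  · have : blues.length ≤ reds.length + blues.length := by omega
    have h2 : 1 ≤ reds.length + blues.length := by omega
    generalize reds.length + blues.length = n at *
    nlinarith

end RealRAM

theorem mainTheorem3 :
    ∃ (P : RealRAM.Program) (C : ℕ), ∀ R B : Finset ℝ, R.Nonempty → B.Nonempty → Disjoint R B →
      ∀ reds blues : List ℝ, reds.Nodup → reds.toFinset = R → blues.Nodup → blues.toFinset = B →
        ∃ (t : ℕ) (σ : RealRAM.State),
          RealRAM.Run P (RealRAM.inputState reds blues) t σ ∧
          t ≤ C * (R.card + B.card) ^ 2 ∧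
          σ.outputEdges.Nodup ∧
          IsOptimalNonCrossingSpanningTree R B σ.outputEdges.toFinset := by
  refine ⟨RealRAM.treeProgram, 120, ?_⟩
  rintro R B hR hB hd reds blues hr rfl hb rfl
  obtain ⟨t, ht, σ, hrun, hnodup, hopt⟩ := RealRAM.treeProgram_ends hr hb hd
    (by rintro rfl; simp at hR) (by rintro rfl; simp at hB)
  refine ⟨t, σ, hrun, ?_, hnodup, hopt⟩
  rwa [List.toFinset_card_of_nodup hr, List.toFinset_card_of_nodup hb]
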